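/- Let $\Omega=C_0([0,1],\mathbb R)$ be the space of continuous paths $\omega$ on $[0,1]$ with $\omega(0)=0$, with the Borel $\sigma$-algebra of the uniform norm, let $\mathbb P_0$ be the Wiener measure on $\Omega$, $W_t(\omega)=\omega(t)$, and let $H=\{h=\int_0^{\cdot}\dot h(x)\,dx:\ \dot h\in L^2([0,1])\}$ be the Cameron–Martin space with $\langle h,k\rangle_H=\int_0^1\dot h\,\dot k\,dt$. Put $\tau_h(\omega)=\omega+h$ and $W(h)=\int_0^1\dot h_s\,dW_s$. For $p>1$ let $\mathbb D^{1,p}$ be the closure of the set of polynomial cylindrical variables $F=f(W(h_1),\dots,W(h_n))$ ($f$ a real polynomial, $h_i\in H$) for the norm $(\mathbb E|F|^p+\mathbb E\|\nabla F\|_H^p)^{1/p}$, where $\nabla F=\sum_i\partial_i f(W(h_1),\dots,W(h_n))\,h_i$; that is, $Z\in\mathbb D^{1,p}$ if and only if $Z\in L^p$ and there are such $F_k$ and some $D\in L^p(H)$ with $F_k\to Z$ in $L^p$ and $\nabla F_k\to D$ in $L^p(H)$. A random variable $Z\in L^p$ satisfies $(\mathrm{SSGD}_p(p))$ if there is $\mathcal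 DZ\in L^p(H)$ such that for every $h\in H$ $$\lim_{\varepsilon\downarrow 0}\mathbb E\left[\left|\frac{Z\circ\tau_{\varepsilon h}-Z}{\varepsilon}-\langle\mathcal DZ,h\rangle_H\right|^p\right]=0 .$$ **Theorem 3.1.** (i) For every $p>1$ there exists $Z\in\mathbb D^{1,p}$ which does not satisfy $(\mathrm{SSGD}_p(p))$. (ii) For $p=2$ an explicit example is the following. Let $a>\frac32$ and let $Z=f(W_1)$ with $$f(x)=e^{x^2/4}x^{-a}(2\pi)^{1/4}\,\mathbf 1_{x\ge\sqrt{2a}}+g(x)\,\mathbf 1_{x<\sqrt{2a}},$$ where $g:\mathbb R\to\mathbb R$ is any bounded continuously differentiable function with bounded derivative such that $f$ is continuously differentiable on $\mathbb R$. Then $Z\in\mathbb D^{1,2}$, $Z$ does not satisfy $(\mathrm{SSGD}_2(2))$, and for the direction $h(t)=t$ (that is, $\dot h\equiv 1$) and every $\varepsilon>0$ $$\mathbb E\left[\left|\frac{Z\circ\tau_{\varepsilon h}-Z}{\varepsilon}\right|^2\right]=+\infty .$$ -/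

import Mathlib

namespace WienerCalculus

open MeasureTheory ProbabilityTheory unitInterval Filter Topology
open scoped ContinuousMapZero ENNReal NNReal

/-! ### Construction of the Wiener measure

The Wiener measure is built from independent standard Gaussians by the Lévy-Ciesielski series of
Schauder functions. Everything up to `exists_isWienerMeasure` serves only to prove that a Borel
measure on the path space exists under which the coordinate process is a Brownian motion. -/

/-- The tent function, supported on `[0,1]`, with value `1` at `1/2`. -/
noncomputable def tent (x : ℝ) : ℝ := max 0 (1 - |2 * x - 1|)

lemma tent_nonneg (x : ℝ) : 0 ≤ tent x := le_max_left _ _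

lemma continuous_tent : Continuous tent := by unfold tent; fun_prop

lemma tent_of_nonpos {x : ℝ} (h : x ≤ 0) : tent x = 0 := by
  unfold tent
  rw [abs_of_nonpos (by linarith)]
  exact max_eq_left (by linarith)

lemma tent_of_one_le {x : ℝ} (h : 1 ≤ x) : tent x = 0 := by
  unfold tent
  rw [abs_of_nonneg (by linarith)]
  exact max_eq_left (by linarith)

lemma tent_le_one (x : ℝ) : tent x ≤ 1 := by
  unfold tent
  exact max_le zero_le_one (by linarith [abs_nonneg (2 * x - 1)])

/-- At most one translate of a function supported in the unit interval is nonzero. -/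
lemma sum_translate_le {φ : ℕ → ℝ} {M : ℝ} (hM : 0 ≤ M) (x : ℝ) (K : ℕ)
    (h0 : ∀ k : ℕ, x ≤ k → φ k = 0) (h1 : ∀ k : ℕ, (k : ℝ) + 1 ≤ x → φ k = 0)
    (hb : ∀ k, φ k ≤ M) : ∑ k ∈ Finset.range K, φ k ≤ M := by
  by_cases hx : x ≤ 0
  · rw [Finset.sum_eq_zero]
    · exact hM
    · intro k _
      exact h0 k (hx.trans (Nat.cast_nonneg k))
  · push Not at hx
    have key : ∀ k, k ≠ ⌊x⌋₊ → φ k = 0 := by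
      intro k hk
      rcases lt_or_gt_of_ne hk with h | h
      · apply h1
        have : ((k + 1 : ℕ) : ℝ) ≤ x := (Nat.le_floor_iff hx.le).1 h
        exact_mod_cast this
      · apply h0
        exact ((Nat.floor_lt hx.le).1 h).le
    by_cases hm : ⌊x⌋₊ ∈ Finset.range K
    · rw [Finset.sum_eq_single_of_mem _ hm (fun k _ hk => key k hk)]
      exact hb _
    · rw [Finset.sum_eq_zero]
      · exact hM
      · intro k hk
        exact key k (fun h => hm (h ▸ hk))

/-- The covariance `min x y - x y` of the Brownian bridge on `[0,1]²`, extended by `0`. -/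
noncomputable def bridge (x y : ℝ) : ℝ := max 0 (min x y) * max 0 (1 - max x y)

lemma bridge_nonneg (x y : ℝ) : 0 ≤ bridge x y :=
  mul_nonneg (le_max_left _ _) (le_max_left _ _)

lemma bridge_of_nonpos {x : ℝ} (y : ℝ) (h : x ≤ 0) : bridge x y = 0 := by
  unfold bridge
  rw [max_eq_left ((min_le_left x y).trans h), zero_mul]

lemma bridge_of_one_le {x : ℝ} (y : ℝ) (h : 1 ≤ x) : bridge x y = 0 := by
  unfold bridge
  rw [max_eq_left (b := 1 - max x y) (by linarith [le_max_left x y]), mul_zero]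

lemma bridge_comm (x y : ℝ) : bridge x y = bridge y x := by
  unfold bridge; rw [min_comm, max_comm x y]

lemma bridge_le_one (x y : ℝ) : bridge x y ≤ 1 := by
  by_cases hx : x ≤ 0
  · rw [bridge_of_nonpos y hx]; norm_num
  by_cases hx1 : 1 ≤ x
  · rw [bridge_of_one_le y hx1]; norm_num
  push Not at hx hx1
  unfold bridge
  apply mul_le_one₀
  · exact max_le zero_le_one ((min_le_left _ _).trans hx1.le)
  · exact le_max_left _ _
  · exact max_le zero_le_one (by linarith [le_max_left x y])

lemma bridge_of_mem {x y : ℝ} (hx0 : 0 ≤ x) (hx1 : x ≤ 1) (hy0 : 0 ≤ y) (hy1 : y ≤ 1) :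
    bridge x y = min x y - x * y := by
  unfold bridge
  rw [max_eq_right (le_min hx0 hy0), max_eq_right (by linarith [max_le hx1 hy1])]
  have := min_mul_max x y
  linear_combination -this

lemma tent_left {x : ℝ} (h0 : 0 ≤ x) (h : x ≤ 1 / 2) : tent x = 2 * x := by
  unfold tent
  rw [abs_of_nonpos (by linarith), max_eq_right (by linarith)]; ring

lemma tent_right {x : ℝ} (h0 : 1 / 2 ≤ x) (h : x ≤ 1) : tent x = 2 - 2 * x := by
  unfold tent
  rw [abs_of_nonneg (by linarith), max_eq_right (by linarith)]; ring

lemma bridge_recursion (x y : ℝ) :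
    bridge x y = (1 / 4) * (tent x * tent y)
      + (1 / 2) * (bridge (2 * x) (2 * y) + bridge (2 * x - 1) (2 * y - 1)) := by
  wlog hxy : x ≤ y generalizing x y
  · rw [bridge_comm x, this y x (le_of_not_ge hxy), bridge_comm (2 * x), bridge_comm (2 * x - 1),
      mul_comm (tent y)]
  by_cases hx : x ≤ 0
  · rw [bridge_of_nonpos _ hx, tent_of_nonpos hx, bridge_of_nonpos _ (by linarith),
      bridge_of_nonpos _ (by linarith)]; ring
  by_cases hy : 1 ≤ y
  · rw [bridge_comm, bridge_of_one_le _ hy, tent_of_one_le hy, bridge_comm (2 * x),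
      bridge_of_one_le _ (by linarith), bridge_comm (2 * x - 1), bridge_of_one_le _ (by linarith)]
    ring
  push Not at hx hy
  rw [bridge_of_mem (by linarith) (by linarith) (by linarith) (by linarith), min_eq_left hxy]
  rcases le_total y (1 / 2) with hy2 | hy2
  · rw [tent_left (by linarith) (by linarith), tent_left (by linarith) hy2,
      bridge_of_mem (by linarith) (by linarith) (by linarith) (by linarith),
      bridge_of_nonpos _ (by linarith), min_eq_left (by linarith)]
    ring
  · rcases le_total x (1 / 2) with hx2 | hx2
    · rw [tent_left (by linarith) (by linarith), tent_right hy2 (by linarith),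
        bridge_comm, bridge_of_one_le _ (by linarith), bridge_of_nonpos _ (by linarith)]
      ring
    · rw [tent_right hx2 (by linarith), tent_right hy2 (by linarith),
        bridge_of_one_le _ (by linarith),
        bridge_of_mem (by linarith) (by linarith) (by linarith) (by linarith),
        min_eq_left (by linarith)]
      ring

lemma sum_range_two_mul (f : ℕ → ℝ) (K : ℕ) :
    ∑ k ∈ Finset.range (2 * K), f k
      = ∑ k ∈ Finset.range K, (f (2 * k) + f (2 * k + 1)) := by
  induction K with
  | zero => simp
  | succ n ih =>
    rw [show 2 * (n + 1) = 2 * n + 1 + 1 by ring, Finset.sum_range_succ, Finset.sum_range_succ, ih,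
      Finset.sum_range_succ]
    ring

/-- The part of the bridge covariance carried by the Schauder functions of level `≥ N`. -/
noncomputable def remainder (N : ℕ) (s t : ℝ) : ℝ :=
  (1 / 2) ^ N * ∑ k ∈ Finset.range (2 ^ N), bridge (2 ^ N * s - k) (2 ^ N * t - k)

lemma remainder_succ (N : ℕ) (s t : ℝ) :
    remainder N s t = (1 / 4) * (1 / 2) ^ N * ∑ k ∈ Finset.range (2 ^ N),
      tent (2 ^ N * s - k) * tent (2 ^ N * t - k) + remainder (N + 1) s t := by
  unfold remainder
  rw [pow_succ 2 N, mul_comm (2 ^ N) 2, sum_range_two_mul, Finset.mul_sum, Finset.mul_sum,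
    Finset.mul_sum, ← Finset.sum_add_distrib]
  refine Finset.sum_congr rfl fun k _ => ?_
  rw [bridge_recursion]
  push_cast
  rw [show 2 * (2 ^ N * s - (k : ℝ)) = 2 ^ (N + 1) * s - 2 * k by ring,
    show 2 * (2 ^ N * t - (k : ℝ)) = 2 ^ (N + 1) * t - 2 * k by ring,
    show 2 ^ (N + 1) * s - 2 * (k : ℝ) - 1 = 2 ^ (N + 1) * s - (2 * k + 1) by ring,
    show 2 ^ (N + 1) * t - 2 * (k : ℝ) - 1 = 2 ^ (N + 1) * t - (2 * k + 1) by ring]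
  ring

lemma remainder_nonneg (N : ℕ) (s t : ℝ) : 0 ≤ remainder N s t :=
  mul_nonneg (by positivity) (Finset.sum_nonneg fun _ _ => bridge_nonneg _ _)

lemma remainder_le (N : ℕ) (s t : ℝ) : remainder N s t ≤ (1 / 2) ^ N := by
  unfold remainder
  refine mul_le_of_le_one_right (by positivity) ?_
  refine sum_translate_le zero_le_one (2 ^ N * s) _ (fun k hk => ?_) (fun k hk => ?_)
    (fun k => bridge_le_one _ _)
  · exact bridge_of_nonpos _ (by linarith)
  · exact bridge_of_one_le _ (by linarith)

lemma tendsto_remainder (s t : ℝ) : Tendsto (fun N => remainder N s t) atTop (𝓝 0) :=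
  squeeze_zero (fun N => remainder_nonneg N s t) (fun N => remainder_le N s t)
    (tendsto_pow_atTop_nhds_zero_of_lt_one (by norm_num) (by norm_num))

/-- The number `2^{1/4}`. -/
noncomputable def rho : ℝ := 2 ^ (1 / 4 : ℝ)

lemma rho_pow : rho ^ 4 = 2 := by
  unfold rho
  rw [← Real.rpow_natCast, ← Real.rpow_mul (by norm_num)]
  norm_num

lemma one_lt_rho : 1 < rho := Real.one_lt_rpow (by norm_num) (by norm_num)

/-- The Schauder functions: `t` at level `0`, and `2^{-n/2-1} tent(2^n t - k)`, `k < 2^n`, at level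
`n + 1`. -/
noncomputable def schauder : ℕ × ℕ → C(I, ℝ)₀
  | (0, _) => ⟨⟨fun t => (t : ℝ), by fun_prop⟩, rfl⟩
  | (n + 1, k) => ⟨⟨fun t => (rho ^ (2 * n))⁻¹ / 2 * tent (2 ^ n * (t : ℝ) - k), by
      have := continuous_tent
      fun_prop⟩, by
        simp [tent_of_nonpos (x := -(k : ℝ)) (by simp)]⟩

/-- The number of Schauder functions of a given level. -/
def levelCard : ℕ → ℕ
  | 0 => 1
  | n + 1 => 2 ^ n

/-- The random linear combination of the Schauder functions of level `m`. -/
noncomputable def levelSum (m : ℕ) (ξ : ℕ × ℕ → ℝ) : C(I, ℝ)₀ :=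
  ∑ k ∈ Finset.range (levelCard m), ξ (m, k) • schauder (m, k)

/-- The Lévy-Ciesielski series. -/
noncomputable def levyPath (ξ : ℕ × ℕ → ℝ) : C(I, ℝ)₀ := ∑' m, levelSum m ξ

lemma coef_sq (n : ℕ) : ((rho ^ (2 * n))⁻¹ / 2) ^ 2 = (1 / 4) * (1 / 2) ^ n := by
  have : (rho ^ (2 * n)) ^ 2 = 2 ^ n := by
    rw [← pow_mul, show 2 * n * 2 = 4 * n by ring, pow_mul, rho_pow]
  rw [div_pow, inv_pow, this, one_div, one_div, inv_pow]
  ring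

lemma kernel_sum (s t : I) (N : ℕ) :
    ∑ m ∈ Finset.range (N + 1), ∑ k ∈ Finset.range (levelCard m),
      schauder (m, k) s * schauder (m, k) t = min (s : ℝ) t - remainder N s t := by
  induction N with
  | zero =>
    have : remainder 0 s t = min (s : ℝ) t - s * t := by
      simp [remainder, bridge_of_mem s.2.1 s.2.2 t.2.1 t.2.2]
    rw [this]
    simp [levelCard, schauder]
  | succ N ih =>
    rw [Finset.sum_range_succ, ih, remainder_succ N s t]
    have : ∑ k ∈ Finset.range (levelCard (N + 1)), schauder (N + 1, k) s * schauder (N + 1, k) t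
        = (1 / 4) * (1 / 2) ^ N * ∑ k ∈ Finset.range (2 ^ N),
          tent (2 ^ N * s - k) * tent (2 ^ N * t - k) := by
      rw [Finset.mul_sum]
      refine Finset.sum_congr rfl fun k _ => ?_
      rw [← coef_sq]
      simp only [schauder, ContinuousMapZero.coe_mk, ContinuousMap.coe_mk]
      ring
    rw [this]; ring

lemma norm_levelSum_le (n : ℕ) (ξ : ℕ × ℕ → ℝ) :
    ‖levelSum (n + 1) ξ‖ ≤ (rho⁻¹) ^ n + (rho⁻¹) ^ n *
      ((1 / 2) ^ n * ∑ k ∈ Finset.range (2 ^ n), ξ (n + 1, k) ^ 4) := by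
  have hρ : 0 < rho := by linarith [one_lt_rho]
  set M := ∑ k ∈ Finset.range (2 ^ n), ξ (n + 1, k) ^ 4 with hM
  have hM0 : 0 ≤ M := Finset.sum_nonneg fun k _ => by positivity
  have habs : ∀ k ∈ Finset.range (2 ^ n), |ξ (n + 1, k)| ≤ rho ^ n + M / (rho ^ n) ^ 3 := by
    intro k hk
    have h4 : |ξ (n + 1, k)| ^ 4 ≤ M := by
      rw [show |ξ (n + 1, k)| ^ 4 = ξ (n + 1, k) ^ 4 from Even.pow_abs (by decide) _]
      exact Finset.single_le_sum (f := fun k => ξ (n + 1, k) ^ 4) (fun k _ => by positivity) hk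
    have hl : 0 < rho ^ n := by positivity
    generalize |ξ (n + 1, k)| = a at h4 ⊢
    by_cases ha : a ≤ rho ^ n
    · have : 0 ≤ M / (rho ^ n) ^ 3 := by positivity
      linarith
    · push Not at ha
      have : a ≤ M / (rho ^ n) ^ 3 := by
        rw [le_div_iff₀ (by positivity)]
        refine le_trans ?_ h4
        have h3 : (rho ^ n) ^ 3 ≤ a ^ 3 := by gcongr
        calc a * (rho ^ n) ^ 3 ≤ a * a ^ 3 := by
              apply mul_le_mul_of_nonneg_left h3; linarith
          _ = a ^ 4 := by ring
      linarith
  have h0 : 0 ≤ rho ^ n + M / (rho ^ n) ^ 3 := by positivity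
  have hpt : ∀ t : I, ‖levelSum (n + 1) ξ t‖ ≤
      (rho ^ (2 * n))⁻¹ / 2 * (rho ^ n + M / (rho ^ n) ^ 3) := by
    intro t
    have : levelSum (n + 1) ξ t = ∑ k ∈ Finset.range (2 ^ n),
        ξ (n + 1, k) * ((rho ^ (2 * n))⁻¹ / 2 * tent (2 ^ n * (t : ℝ) - k)) := by
      simp [levelSum, levelCard, schauder, ContinuousMapZero.coe_sum, Finset.sum_apply]
    rw [this]
    calc ‖∑ k ∈ Finset.range (2 ^ n),
            ξ (n + 1, k) * ((rho ^ (2 * n))⁻¹ / 2 * tent (2 ^ n * (t : ℝ) - k))‖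
        ≤ ∑ k ∈ Finset.range (2 ^ n), (rho ^ n + M / (rho ^ n) ^ 3) *
            ((rho ^ (2 * n))⁻¹ / 2 * tent (2 ^ n * (t : ℝ) - k)) := by
          refine (norm_sum_le _ _).trans (Finset.sum_le_sum fun k hk => ?_)
          have htn := tent_nonneg (2 ^ n * (t : ℝ) - k)
          have h2 : 0 ≤ (rho ^ (2 * n))⁻¹ / 2 * tent (2 ^ n * (t : ℝ) - k) := by positivity
          rw [norm_mul, Real.norm_eq_abs, Real.norm_eq_abs, abs_of_nonneg h2]
          exact mul_le_mul_of_nonneg_right (habs k hk) h2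
      _ = (rho ^ (2 * n))⁻¹ / 2 * (rho ^ n + M / (rho ^ n) ^ 3) *
            ∑ k ∈ Finset.range (2 ^ n), tent (2 ^ n * (t : ℝ) - k) := by
          rw [Finset.mul_sum]
          exact Finset.sum_congr rfl fun k _ => by ring
      _ ≤ _ := by
          refine mul_le_of_le_one_right (by positivity) ?_
          refine sum_translate_le zero_le_one (2 ^ n * (t : ℝ)) _ (fun k hk => ?_)
            (fun k hk => ?_) (fun k => tent_le_one _)
          · exact tent_of_nonpos (by linarith)
          · exact tent_of_one_le (by linarith)
  have hnorm : ‖levelSum (n + 1) ξ‖ ≤ (rho ^ (2 * n))⁻¹ / 2 * (rho ^ n + M / (rho ^ n) ^ 3) := by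
    have : ‖(levelSum (n + 1) ξ : C(I, ℝ))‖ ≤ _ :=
      (ContinuousMap.norm_le _ (by positivity)).2 hpt
    exact this
  refine hnorm.trans ?_
  have e1 : (rho ^ (2 * n))⁻¹ / 2 * (rho ^ n + M / (rho ^ n) ^ 3)
      = ((rho⁻¹) ^ n + (rho⁻¹) ^ n * ((1 / 2) ^ n * M)) / 2 := by
    have h2 : (1 / 2 : ℝ) ^ n = ((rho ^ n) ^ 4)⁻¹ := by
      rw [← pow_mul, mul_comm n 4, pow_mul, rho_pow, one_div, inv_pow]
    rw [h2, inv_pow, show rho ^ (2 * n) = (rho ^ n) ^ 2 by rw [← pow_mul, mul_comm]]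
    have : rho ^ n ≠ 0 := by positivity
    field_simp
  rw [e1]
  have : 0 ≤ (rho⁻¹) ^ n + (rho⁻¹) ^ n * ((1 / 2) ^ n * M) := by positivity
  linarith

/-- The law of a family of independent standard Gaussian variables. -/
noncomputable def noise : Measure (ℕ × ℕ → ℝ) := Measure.infinitePi fun _ => gaussianReal 0 1

instance : IsProbabilityMeasure noise := by unfold noise; infer_instance

lemma lintegral_noise_pow (i : ℕ × ℕ) :
    ∫⁻ ξ, ENNReal.ofReal (ξ i ^ 4) ∂noise = ∫⁻ x, ENNReal.ofReal (x ^ 4) ∂(gaussianReal 0 1) := by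
  have h := measurePreserving_eval_infinitePi (fun _ : ℕ × ℕ => gaussianReal 0 1) i
  exact h.lintegral_comp (f := fun x => ENNReal.ofReal (x ^ 4)) (by fun_prop)

lemma fourth_moment_lt_top : ∫⁻ x, ENNReal.ofReal (x ^ 4) ∂(gaussianReal 0 1) < ∞ := by
  have h := (memLp_id_gaussianReal (μ := 0) (v := 1) 4).integrable_norm_pow (p := 4) (by norm_num)
  have h2 := h.2
  rw [hasFiniteIntegral_iff_ofReal (Eventually.of_forall fun x => by positivity)] at h2
  convert h2 using 3 with x
  congr 1
  simp only [id, Real.norm_eq_abs]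
  exact (Even.pow_abs (by decide) x).symm

lemma ae_summable : ∀ᵐ ξ ∂noise, Summable fun m => levelSum m ξ := by
  have hρ := one_lt_rho
  have hρi : rho⁻¹ < 1 := inv_lt_one_of_one_lt₀ hρ
  have hρ0 : 0 ≤ rho⁻¹ := by positivity
  have hgeo : Summable fun n : ℕ => (rho⁻¹) ^ n := summable_geometric_of_lt_one hρ0 hρi
  let u : ℕ → (ℕ × ℕ → ℝ) → ℝ := fun n ξ => (rho⁻¹) ^ n *
      ((1 / 2) ^ n * ∑ k ∈ Finset.range (2 ^ n), ξ (n + 1, k) ^ 4)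
  have hu0 : ∀ n ξ, 0 ≤ u n ξ := fun n ξ =>
    mul_nonneg (by positivity) (mul_nonneg (by positivity)
      (Finset.sum_nonneg fun k _ => by positivity))
  have hum : ∀ n, Measurable (u n) := fun n => by fun_prop
  set m4 := ∫⁻ x, ENNReal.ofReal (x ^ 4) ∂(gaussianReal 0 1) with hm4
  have hint : ∀ n, ∫⁻ ξ, ENNReal.ofReal (u n ξ) ∂noise = ENNReal.ofReal ((rho⁻¹) ^ n) * m4 := by
    intro n
    have e : ∀ ξ, ENNReal.ofReal (u n ξ) = ENNReal.ofReal ((rho⁻¹) ^ n * (1 / 2) ^ n) *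
        ∑ k ∈ Finset.range (2 ^ n), ENNReal.ofReal (ξ (n + 1, k) ^ 4) := by
      intro ξ
      rw [← ENNReal.ofReal_sum_of_nonneg (fun k _ => by positivity),
        ← ENNReal.ofReal_mul (by positivity), mul_assoc]
    simp_rw [e]
    rw [lintegral_const_mul _ (by fun_prop), lintegral_finsetSum _ (fun k _ => by fun_prop)]
    simp_rw [lintegral_noise_pow]
    rw [Finset.sum_const, Finset.card_range, nsmul_eq_mul, ← mul_assoc, ← hm4]
    congr 1
    rw [← ENNReal.ofReal_natCast, ← ENNReal.ofReal_mul (by positivity)]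
    congr 1
    push_cast
    rw [mul_assoc, ← mul_pow]
    norm_num
  have hfin : ∫⁻ ξ, ∑' n, ENNReal.ofReal (u n ξ) ∂noise ≠ ∞ := by
    rw [lintegral_tsum (fun n => (hum n).ennreal_ofReal.aemeasurable)]
    simp_rw [hint]
    rw [ENNReal.tsum_mul_right]
    refine ENNReal.mul_ne_top ?_ fourth_moment_lt_top.ne
    exact hgeo.tsum_ofReal_ne_top
  have hae := ae_lt_top' (AEMeasurable.tsum fun n => (hum n).ennreal_ofReal.aemeasurable) hfin
  filter_upwards [hae] with ξ hξ
  have hs : Summable fun n => u n ξ := by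
    have := ENNReal.summable_toReal hξ.ne
    simpa [ENNReal.toReal_ofReal (hu0 _ ξ)] using this
  rw [← summable_nat_add_iff 1]
  exact Summable.of_norm_bounded (hgeo.add hs) fun n => norm_levelSum_le n ξ


/-- The Borel `σ`-algebra of the uniform topology. -/
instance : MeasurableSpace C(I, ℝ)₀ := borel _

instance : BorelSpace C(I, ℝ)₀ := ⟨rfl⟩

lemma measurable_levelPartial (N : ℕ) :
    Measurable fun ξ : ℕ × ℕ → ℝ => ∑ m ∈ Finset.range N, levelSum m ξ := by
  apply Continuous.measurable
  unfold levelSum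
  fun_prop

lemma ae_tendsto_levyPath : ∀ᵐ ξ ∂noise,
    Tendsto (fun N => ∑ m ∈ Finset.range N, levelSum m ξ) atTop (𝓝 (levyPath ξ)) := by
  filter_upwards [ae_summable] with ξ hξ
  exact hξ.hasSum.tendsto_sum_nat

lemma aemeasurable_levyPath : AEMeasurable levyPath noise :=
  aemeasurable_of_tendsto_metrizable_ae atTop
    (fun N => (measurable_levelPartial N).aemeasurable) ae_tendsto_levyPath

lemma integral_cexp_noise (s : Finset (ℕ × ℕ)) (c : ℕ × ℕ → ℝ) :
    ∫ ξ, Complex.exp ((∑ i ∈ s, c i * ξ i : ℝ) * Complex.I) ∂noise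
      = Complex.exp (-((∑ i ∈ s, c i ^ 2 : ℝ) : ℂ) / 2) := by
  have hme : ∀ i, Measurable fun ξ : ℕ × ℕ → ℝ => c i * ξ i := fun i => by fun_prop
  have hsm : Measurable fun ξ : ℕ × ℕ → ℝ => ∑ i ∈ s, c i * ξ i := by fun_prop
  have hind : iIndepFun (fun i (ξ : ℕ × ℕ → ℝ) => c i * ξ i) noise :=
    iIndepFun_infinitePi (P := fun _ : ℕ × ℕ => gaussianReal 0 1)
      (X := fun i x => c i * x) (fun i => by fun_prop)
  have h := iIndepFun.charFun_map_fun_finsetSum_eq_prod (s := s)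
    (X := fun i (ξ : ℕ × ℕ → ℝ) => c i * ξ i) (P := noise)
    (fun i _ => (hme i).aemeasurable) (hind.restrict s)
  have h1 := congrFun h 1
  rw [charFun_apply_real, integral_map hsm.aemeasurable (by fun_prop)] at h1
  have e : ∀ i, charFun (Measure.map (fun ξ : ℕ × ℕ → ℝ => c i * ξ i) noise) 1
      = Complex.exp (-((c i ^ 2 : ℝ) : ℂ) / 2) := by
    intro i
    have hm : Measure.map (fun ξ : ℕ × ℕ → ℝ => ξ i) noise = gaussianReal 0 1 :=
      (measurePreserving_eval_infinitePi (fun _ : ℕ × ℕ => gaussianReal 0 1) i).map_eq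
    rw [charFun_map_mul_comp (measurable_pi_apply i).aemeasurable, hm, charFun_gaussianReal]
    congr 1
    push_cast
    ring
  rw [Finset.prod_apply] at h1
  simp_rw [e] at h1
  rw [← Complex.exp_sum] at h1
  convert h1 using 2
  · ext ξ; congr 1; push_cast; ring
  · push_cast; rw [← Finset.sum_div, Finset.sum_neg_distrib]

/-- The indices of the Schauder functions of level `< N`. -/
def levelIndex (N : ℕ) : Finset (ℕ × ℕ) :=
  (Finset.range N).sigma (fun m => Finset.range (levelCard m)) |>.map
    (Equiv.sigmaEquivProd ℕ ℕ).toEmbedding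

lemma sum_levelIndex {M : Type*} [AddCommMonoid M] (N : ℕ) (f : ℕ × ℕ → M) :
    ∑ i ∈ levelIndex N, f i
      = ∑ m ∈ Finset.range N, ∑ k ∈ Finset.range (levelCard m), f (m, k) := by
  unfold levelIndex
  rw [Finset.sum_map, Finset.sum_sigma]
  rfl

/-- The law of the Lévy-Ciesielski series on the path space. -/
noncomputable def levyMeasure : Measure C(I, ℝ)₀ := noise.map levyPath

instance : IsProbabilityMeasure levyMeasure :=
  Measure.isProbabilityMeasure_map aemeasurable_levyPath

lemma integral_cexp_levyMeasure {ι : Type*} [Fintype ι] (c : ι → ℝ) (a b : ι → I) :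
    ∫ ω, Complex.exp ((∑ j, c j * (ω (b j) - ω (a j)) : ℝ) * Complex.I) ∂levyMeasure
      = Complex.exp (-((∑ j, ∑ l, c j * c l * (min (b j : ℝ) (b l) - min (b j : ℝ) (a l)
          - min (a j : ℝ) (b l) + min (a j : ℝ) (a l)) : ℝ) : ℂ) / 2) := by
  have hcont : Continuous fun ω : C(I, ℝ)₀ =>
      Complex.exp ((∑ j, c j * (ω (b j) - ω (a j)) : ℝ) * Complex.I) := by
    have : ∀ t : I, Continuous fun ω : C(I, ℝ)₀ => ω t := fun t => continuous_eval_const t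
    fun_prop
  unfold levyMeasure
  rw [integral_map aemeasurable_levyPath hcont.aestronglyMeasurable]
  set S : ℕ → (ℕ × ℕ → ℝ) → C(I, ℝ)₀ := fun N ξ => ∑ m ∈ Finset.range (N + 1), levelSum m ξ
    with hS
  have hlim : Tendsto (fun N => ∫ ξ, Complex.exp
      ((∑ j, c j * (S N ξ (b j) - S N ξ (a j)) : ℝ) * Complex.I) ∂noise) atTop
      (𝓝 (∫ ξ, Complex.exp
        ((∑ j, c j * (levyPath ξ (b j) - levyPath ξ (a j)) : ℝ) * Complex.I) ∂noise)) := by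
    refine tendsto_integral_of_dominated_convergence (fun _ => 1) (fun N => ?_)
      (integrable_const _) (fun N => ?_) ?_
    · exact (hcont.measurable.comp (measurable_levelPartial (N + 1))).aestronglyMeasurable
    · exact Eventually.of_forall fun ξ => by rw [Complex.norm_exp_ofReal_mul_I]
    · filter_upwards [ae_tendsto_levyPath] with ξ hξ
      exact (hcont.tendsto _).comp (hξ.comp (tendsto_add_atTop_nat 1))
  refine tendsto_nhds_unique hlim ?_
  have hval : ∀ N ξ, ∑ j, c j * (S N ξ (b j) - S N ξ (a j)) = ∑ i ∈ levelIndex (N + 1),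
      (∑ j, c j * (schauder i (b j) - schauder i (a j))) * ξ i := by
    intro N ξ
    have hev : ∀ t, S N ξ t = ∑ i ∈ levelIndex (N + 1), ξ i * schauder i t := by
      intro t
      rw [sum_levelIndex]
      simp [hS, levelSum, ContinuousMapZero.coe_sum, Finset.sum_apply]
    simp_rw [hev, ← Finset.sum_sub_distrib, Finset.mul_sum, Finset.sum_mul]
    rw [Finset.sum_comm]
    exact Finset.sum_congr rfl fun i _ => Finset.sum_congr rfl fun j _ => by ring
  simp_rw [hval, integral_cexp_noise]
  have hsq : ∀ N, ∑ i ∈ levelIndex (N + 1),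
      (∑ j, c j * (schauder i (b j) - schauder i (a j))) ^ 2
      = ∑ j, ∑ l, c j * c l * ((min (b j : ℝ) (b l) - remainder N (b j) (b l))
          - (min (b j : ℝ) (a l) - remainder N (b j) (a l))
          - (min (a j : ℝ) (b l) - remainder N (a j) (b l))
          + (min (a j : ℝ) (a l) - remainder N (a j) (a l))) := by
    intro N
    have hk : ∀ s t : I, min (s : ℝ) t - remainder N s t
        = ∑ i ∈ levelIndex (N + 1), schauder i s * schauder i t := fun s t => by
      rw [← kernel_sum, sum_levelIndex]
    simp_rw [hk, ← Finset.sum_sub_distrib, ← Finset.sum_add_distrib, Finset.mul_sum, sq,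
      Finset.sum_mul_sum]
    rw [Finset.sum_comm]
    refine Finset.sum_congr rfl fun j _ => ?_
    rw [Finset.sum_comm]
    exact Finset.sum_congr rfl fun l _ => Finset.sum_congr rfl fun i _ => by ring
  simp_rw [hsq]
  have hR : Tendsto (fun N => ∑ j, ∑ l, c j * c l * ((min (b j : ℝ) (b l) - remainder N (b j) (b l))
          - (min (b j : ℝ) (a l) - remainder N (b j) (a l))
          - (min (a j : ℝ) (b l) - remainder N (a j) (b l))
          + (min (a j : ℝ) (a l) - remainder N (a j) (a l)))) atTop
      (𝓝 (∑ j, ∑ l, c j * c l * ((min (b j : ℝ) (b l) - 0) - (min (b j : ℝ) (a l) - 0)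
          - (min (a j : ℝ) (b l) - 0) + (min (a j : ℝ) (a l) - 0)))) := by
    refine tendsto_finsetSum _ fun j _ => tendsto_finsetSum _ fun l _ => ?_
    refine Tendsto.const_mul _ (Tendsto.add (Tendsto.sub (Tendsto.sub ?_ ?_) ?_) ?_) <;>
      exact tendsto_const_nhds.sub (tendsto_remainder _ _)
  simp only [sub_zero] at hR
  have hc : Continuous fun x : ℝ => Complex.exp (-(x : ℂ) / 2) := by fun_prop
  exact (hc.tendsto _).comp hR

/-- A Borel probability measure on the path space is a Wiener measure if the coordinate process is
a standard Brownian motion: independent increments, `ω t - ω s ~ N(0, t - s)` for `s ≤ t`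
(paths are continuous and start at `0` by construction of the space). -/
structure IsWienerMeasure (P : Measure C(I, ℝ)₀) : Prop where
  isProbabilityMeasure : IsProbabilityMeasure P
  indepIncrements : HasIndepIncrements (fun (t : I) (ω : C(I, ℝ)₀) => ω t) P
  law_increment : ∀ s t : I, s ≤ t →
    HasLaw (fun ω : C(I, ℝ)₀ => ω t - ω s) (gaussianReal 0 (Real.toNNReal (t - s))) P

lemma law_increment_levyMeasure (s t : I) (hst : s ≤ t) :
    HasLaw (fun ω : C(I, ℝ)₀ => ω t - ω s) (gaussianReal 0 (Real.toNNReal (t - s)))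
      levyMeasure := by
  have hm : ∀ t : I, Measurable fun ω : C(I, ℝ)₀ => ω t :=
    fun t => (continuous_eval_const t).measurable
  have hmm : Measurable fun ω : C(I, ℝ)₀ => ω t - ω s := (hm t).sub (hm s)
  refine ⟨hmm.aemeasurable, ?_⟩
  have := Measure.isProbabilityMeasure_map hmm.aemeasurable (μ := levyMeasure)
  apply Measure.ext_of_charFun
  ext x
  rw [charFun_apply_real, integral_map hmm.aemeasurable (by fun_prop), charFun_gaussianReal]
  have h := integral_cexp_levyMeasure (ι := Unit) (fun _ => x) (fun _ => s) (fun _ => t)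
  have hst' : (s : ℝ) ≤ t := hst
  have hnn : (0 : ℝ) ≤ t - s := by linarith
  simp only [Finset.univ_unique, Finset.sum_singleton, min_self, min_eq_left hst',
    min_eq_right hst'] at h
  convert h using 2
  · ext ω; congr 1; push_cast; ring
  · rw [Real.coe_toNNReal _ hnn]; push_cast; ring

lemma isWienerMeasure_levyMeasure : IsWienerMeasure levyMeasure where
  isProbabilityMeasure := inferInstance
  law_increment := law_increment_levyMeasure
  indepIncrements := by
    have hm : ∀ t : I, Measurable fun ω : C(I, ℝ)₀ => ω t :=
      fun t => (continuous_eval_const t).measurable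
    intro n t ht
    have hmi : ∀ i : Fin n, Measurable fun ω : C(I, ℝ)₀ => ω (t i.succ) - ω (t i.castSucc) :=
      fun i => (hm _).sub (hm _)
    rw [iIndepFun_iff_charFun_pi (fun i => (hmi i).aemeasurable)]
    intro x
    rw [charFun_apply, integral_map (by fun_prop) (by fun_prop)]
    have hle : ∀ i : Fin n, t i.castSucc ≤ t i.succ := fun i => ht (Fin.castSucc_le_succ i)
    have h1 : ∀ i : Fin n, charFun (levyMeasure.map
        fun ω : C(I, ℝ)₀ => ω (t i.succ) - ω (t i.castSucc)) (x i)
        = Complex.exp (-(((x i) ^ 2 * ((t i.succ : ℝ) - t i.castSucc) : ℝ) : ℂ) / 2) := by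
      intro i
      have hnn : (0 : ℝ) ≤ (t i.succ : ℝ) - t i.castSucc := sub_nonneg.2 (hle i)
      rw [(law_increment_levyMeasure _ _ (hle i)).map_eq, charFun_gaussianReal,
        Real.coe_toNNReal _ hnn]
      congr 1
      push_cast
      ring
    simp_rw [h1]
    rw [← Complex.exp_sum]
    have h := integral_cexp_levyMeasure (fun i => x i) (fun i : Fin n => t i.castSucc)
      (fun i => t i.succ)
    convert h using 2
    · simp [PiLp.inner_apply, mul_comm]
    · rw [← Finset.sum_div, Finset.sum_neg_distrib, ← Complex.ofReal_sum]
      congr 3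
      refine Finset.sum_congr rfl fun j _ => ?_
      rw [Finset.sum_eq_single j]
      · have := hle j
        have h' : (t j.castSucc : ℝ) ≤ t j.succ := this
        rw [min_self, min_self, min_eq_right h', min_eq_left h']
        ring
      · intro l _ hlj
        rcases lt_or_gt_of_ne hlj with h | h
        · have h2 : (t l.succ : ℝ) ≤ t j.castSucc := ht (by
            rw [Fin.le_def]; simp; omega)
          have h3 : (t l.castSucc : ℝ) ≤ t l.succ := hle l
          have h4 : (t j.castSucc : ℝ) ≤ t j.succ := hle j
          rw [min_eq_right (by linarith), min_eq_right (by linarith), min_eq_right (by linarith),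
            min_eq_right (by linarith)]
          ring
        · have h2 : (t j.succ : ℝ) ≤ t l.castSucc := ht (by
            rw [Fin.le_def]; simp; omega)
          have h3 : (t l.castSucc : ℝ) ≤ t l.succ := hle l
          have h4 : (t j.castSucc : ℝ) ≤ t j.succ := hle j
          rw [min_eq_left (by linarith), min_eq_left (by linarith), min_eq_left (by linarith),
            min_eq_left (by linarith)]
          ring
      · simp

theorem exists_isWienerMeasure : ∃ P : Measure C(I, ℝ)₀, IsWienerMeasure P :=
  ⟨_, isWienerMeasure_levyMeasure⟩


/-! ### The objects of the theorem -/

/-- The classical Wiener space `C₀([0,1], ℝ)`: continuous paths on `[0,1]` vanishing at `0`, with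
the uniform topology and its Borel `σ`-algebra. -/
abbrev PathSpace := C(I, ℝ)₀

/-- The Wiener measure on the path space: the (unique) Borel probability measure under which the
coordinate process is a standard Brownian motion. -/
noncomputable def wienerMeasure : Measure PathSpace := Classical.choose exists_isWienerMeasure

lemma isWienerMeasure_wienerMeasure : IsWienerMeasure wienerMeasure :=
  Classical.choose_spec exists_isWienerMeasure

instance : IsProbabilityMeasure wienerMeasure := isWienerMeasure_wienerMeasure.isProbabilityMeasure

/-- The Cameron-Martin space. An element `h`, `h(t) = ∫₀ᵗ ḣ(x) dx`, is represented by its density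
`ḣ ∈ L²([0,1])`, so that the inner product of the Hilbert space `Lp` is
`⟨h₁, h₂⟩_H = ∫₀¹ ḣ₁ ḣ₂ dt`. The function `h` itself is `cameronMartinPath h`. -/
noncomputable abbrev CameronMartin := Lp ℝ 2 (volume.restrict (Set.Icc (0 : ℝ) 1))

lemma intervalIntegrable_cameronMartin (h : CameronMartin) (t : I) :
    IntervalIntegrable h volume 0 t := by
  have h1 : IntegrableOn h (Set.Icc (0 : ℝ) 1) volume :=
    (Lp.memLp h).integrable (by norm_num)
  rw [intervalIntegrable_iff_integrableOn_Icc_of_le t.2.1]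
  exact h1.mono_set (Set.Icc_subset_Icc_right t.2.2)

/-- The path `t ↦ ∫₀ᵗ ḣ(x) dx` of an element `h` of the Cameron-Martin space. -/
noncomputable def cameronMartinPath : CameronMartin →ₗ[ℝ] PathSpace where
  toFun h := ⟨⟨fun t : I => ∫ x in (0 : ℝ)..t, h x, by
    have h1 : IntegrableOn h (Set.uIcc (0 : ℝ) 1) volume := by
      rw [Set.uIcc_of_le zero_le_one]
      exact (Lp.memLp h).integrable (by norm_num)
    have h2 := intervalIntegral.continuousOn_primitive_interval h1
    rw [Set.uIcc_of_le zero_le_one] at h2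
    exact continuousOn_iff_continuous_domRestrict.1 h2⟩, intervalIntegral.integral_same⟩
  map_add' h k := by
    ext t
    have hae : ∀ᵐ x ∂volume, x ∈ Set.uIoc (0 : ℝ) t → (h + k) x = h x + k x := by
      have := (ae_restrict_iff' measurableSet_Icc).1 (Lp.coeFn_add h k)
      filter_upwards [this] with x hx hxt
      rw [Set.uIoc_of_le t.2.1] at hxt
      exact hx ⟨hxt.1.le, hxt.2.trans t.2.2⟩
    change ∫ x in (0 : ℝ)..t, (h + k) x = (∫ x in (0 : ℝ)..t, h x) + ∫ x in (0 : ℝ)..t, k x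
    rw [intervalIntegral.integral_congr_ae hae,
      intervalIntegral.integral_add (intervalIntegrable_cameronMartin h t)
        (intervalIntegrable_cameronMartin k t)]
  map_smul' c h := by
    ext t
    have hae : ∀ᵐ x ∂volume, x ∈ Set.uIoc (0 : ℝ) t → (c • h) x = c * h x := by
      have := (ae_restrict_iff' measurableSet_Icc).1 (Lp.coeFn_smul c h)
      filter_upwards [this] with x hx hxt
      rw [Set.uIoc_of_le t.2.1] at hxt
      exact hx ⟨hxt.1.le, hxt.2.trans t.2.2⟩
    change ∫ x in (0 : ℝ)..t, (c • h) x = c * ∫ x in (0 : ℝ)..t, h x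
    rw [intervalIntegral.integral_congr_ae hae, intervalIntegral.integral_const_mul]

/-- The representation by densities is faithful: `h` is determined by its path. -/
lemma cameronMartinPath_injective : Function.Injective cameronMartinPath := by
  rw [injective_iff_map_eq_zero]
  intro h hh
  have hii := intervalIntegrable_cameronMartin h 1
  have hz : ∀ t ∈ Set.Icc (0 : ℝ) 1, ∫ x in (0 : ℝ)..t, h x = 0 := fun t ht =>
    DFunLike.congr_fun hh (⟨t, ht⟩ : I)
  rw [Lp.eq_zero_iff_ae_eq_zero]
  have hIoo : ∀ᵐ x ∂volume, x ∈ Set.Ioo (0 : ℝ) 1 → h x = 0 := by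
    filter_upwards [hii.ae_hasDerivAt_integral] with x hx hx01
    have hd := hx (by
      rw [Set.uIcc_of_le (by simp)]; exact ⟨hx01.1.le, hx01.2.le⟩) 0 (by simp)
    refine hd.unique ((hasDerivAt_const x (0 : ℝ)).congr_of_eventuallyEq ?_)
    filter_upwards [Ioo_mem_nhds hx01.1 hx01.2] with y hy
    exact hz y ⟨hy.1.le, hy.2.le⟩
  have := (ae_restrict_iff' measurableSet_Ioo).2 hIoo
  rwa [Measure.restrict_congr_set Ioo_ae_eq_Icc] at this

/-- The shift `τ_h ω = ω + h` of the path space along a Cameron-Martin direction. -/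
noncomputable def shift (h : CameronMartin) (ω : PathSpace) : PathSpace := ω + cameronMartinPath h

/-- The difference quotient `X_ε = (Z ∘ τ_{εh} - Z) / ε`. -/
noncomputable def diffQuotient (Z : PathSpace → ℝ) (h : CameronMartin) (ε : ℝ) (ω : PathSpace) :
    ℝ :=
  (Z (shift (ε • h) ω) - Z ω) / ε

/-- A step function `∑ᵢ cᵢ 1_{(sᵢ, tᵢ]}` on `[0,1]`. -/
structure StepFunction where
  n : ℕ
  c : Fin n → ℝ
  s : Fin n → I
  t : Fin n → I
  le : ∀ i, s i ≤ t i

/-- The step function as a function on the line. -/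
noncomputable def StepFunction.toFun (S : StepFunction) (x : ℝ) : ℝ :=
  ∑ i, S.c i * (Set.Ioc (S.s i : ℝ) (S.t i)).indicator 1 x

/-- The elementary stochastic integral `∑ᵢ cᵢ (W_{tᵢ} - W_{sᵢ})` of a step function. -/
noncomputable def StepFunction.wienerIntegral (S : StepFunction) (ω : PathSpace) : ℝ :=
  ∑ i, S.c i * (ω (S.t i) - ω (S.s i))

/-- `X` is (a version of) the Wiener integral `W(h) = ∫₀¹ ḣ_s dW_s`: the limit in `L²(ℙ₀)` of the
elementary integrals of step functions that converge to `ḣ` in `L²([0,1])`. -/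
def IsWienerIntegral (h : CameronMartin) (X : PathSpace → ℝ) : Prop :=
  MemLp X 2 wienerMeasure ∧ ∃ S : ℕ → StepFunction,
    Tendsto (fun k => eLpNorm (fun x => (S k).toFun x - h x) 2
      (volume.restrict (Set.Icc (0 : ℝ) 1))) atTop (𝓝 0) ∧
    Tendsto (fun k => eLpNorm (fun ω => (S k).wienerIntegral ω - X ω) 2 wienerMeasure)
      atTop (𝓝 0)

/-- A polynomial cylindrical functional `f(W(h₁), …, W(hₙ))`; `X i` is a version of `W(hᵢ)`. -/
structure PolynomialCylinder where
  n : ℕ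
  h : Fin n → CameronMartin
  X : Fin n → PathSpace → ℝ
  isWienerIntegral : ∀ i, IsWienerIntegral (h i) (X i)
  f : MvPolynomial (Fin n) ℝ

/-- The random variable `f(W(h₁), …, W(hₙ))`. -/
noncomputable def PolynomialCylinder.val (F : PolynomialCylinder) (ω : PathSpace) : ℝ :=
  MvPolynomial.eval (fun i => F.X i ω) F.f

/-- The Malliavin derivative `∑ᵢ ∂f/∂xᵢ (W(h₁), …, W(hₙ)) hᵢ`, an `H`-valued random variable. -/
noncomputable def PolynomialCylinder.grad (F : PolynomialCylinder) (ω : PathSpace) :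
    CameronMartin :=
  ∑ i, MvPolynomial.eval (fun i => F.X i ω) (MvPolynomial.pderiv i F.f) • F.h i

/-- `D ∈ L^p(H)` is the Malliavin derivative of `Z ∈ L^p`: there are polynomial cylindrical
functionals `Fₖ` with `Fₖ → Z` in `L^p` and `∇Fₖ → D` in `L^p(H)`. -/
def HasMalliavinDerivative (p : ℝ) (Z : PathSpace → ℝ) (D : PathSpace → CameronMartin) : Prop :=
  MemLp Z (ENNReal.ofReal p) wienerMeasure ∧ MemLp D (ENNReal.ofReal p) wienerMeasure ∧
  ∃ F : ℕ → PolynomialCylinder,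
    Tendsto (fun k => eLpNorm (fun ω => (F k).val ω - Z ω) (ENNReal.ofReal p) wienerMeasure)
      atTop (𝓝 0) ∧
    Tendsto (fun k => eLpNorm (fun ω => (F k).grad ω - D ω) (ENNReal.ofReal p) wienerMeasure)
      atTop (𝓝 0)

/-- The Malliavin-Sobolev space `𝔻^{1,p}`: the closure of the polynomial cylindrical functionals
for the norm `(𝔼|Z|^p + 𝔼‖∇Z‖_H^p)^{1/p}`. -/
def MemMalliavinSobolev (p : ℝ) (Z : PathSpace → ℝ) : Prop :=
  ∃ D : PathSpace → CameronMartin, HasMalliavinDerivative p Z D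

/-- Strong stochastic Gâteaux differentiability `(SSGD_p(q))`: `Z ∈ L^p` and there is
`D ∈ L^p(H)` such that for all `h ∈ H` the difference quotients of `Z` along `h` converge to
`⟨D, h⟩_H` in `L^q` as `ε ↓ 0`. (Replacing `h` by `-h` gives the limit `ε ↑ 0`.) -/
def SSGD (p q : ℝ) (Z : PathSpace → ℝ) : Prop :=
  MemLp Z (ENNReal.ofReal p) wienerMeasure ∧
  ∃ D : PathSpace → CameronMartin, MemLp D (ENNReal.ofReal p) wienerMeasure ∧
    ∀ h : CameronMartin, Tendsto
      (fun ε : ℝ => ∫⁻ ω, ‖diffQuotient Z h ε ω - inner ℝ (D ω) h‖ₑ ^ q ∂wienerMeasure)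
      (𝓝[>] 0) (𝓝 0)

/-- The element `h(t) = t` of the Cameron-Martin space, with density `ḣ = 1`. -/
noncomputable def unitDirection : CameronMartin :=
  (memLp_const (1 : ℝ)).toLp (fun _ : ℝ => (1 : ℝ))

/-- `f(x) = e^{x²/4} x^{-a} (2π)^{1/4}` for `x ≥ √(2a)`, and `f(x) = g(x)` for `x < √(2a)`. -/
noncomputable def exampleFun (a : ℝ) (g : ℝ → ℝ) (x : ℝ) : ℝ :=
  if Real.sqrt (2 * a) ≤ x then Real.exp (x ^ 2 / 4) * x ^ (-a) * (2 * Real.pi) ^ (1 / 4 : ℝ)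
  else g x

end WienerCalculus

namespace WienerCalculus

open MeasureTheory ProbabilityTheory unitInterval Filter Topology
open scoped ContinuousMapZero ENNReal NNReal

/-! Every example has the form `Z = f(W₁)`, which reduces the theorem to the standard Gaussian
measure `γ` on the line: `W₁` has law `γ`, the gradient of `f(W₁)` is `f'(W₁)` times the direction
`h(t) = t`, and shifting the path by `εh` replaces `f(x)` by `f(x + ε)`. What is needed is a `C¹`
function `f` with `f'` in `L^p(γ)` and with `f(· + ε)` outside `L^p(γ)` for every `ε > 0`.

Such functions exist because `L^p(γ)` is not invariant under translation. If `f` is `e^{x²/(2p)}`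
times a negative power of `x` near `+∞`, then `|f|^p` exactly cancels the Gaussian factor and leaves
a power, so that `f` and `f'` are in `L^p(γ)` once the power decays fast enough. After the shift a
factor `e^{εx}` survives, and no power compensates it (`lintegral_shift_eq_top`). As `f` itself is
in `L^p(γ)`, the difference quotients have infinite `p`-th moment for every `ε > 0`, so they cannot
be at finite `L^p` distance from any `⟨D, h⟩` (`not_ssgd_of_lintegral_diffQuotient_eq_top`).

Membership in `𝔻^{1,p}` requires polynomials converging to `f` together with their derivatives.
Polynomials are dense in `L^p(γ)` (`exists_polynomial_eLpNorm_sub_lt`), so `f'` can be approximated;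
a Hardy type inequality (`eLpNorm_primitive_le`) makes integration from `0` continuous on `L^p(γ)`,
so the primitives converge as well (`exists_polynomial_sobolev`). `sobolev_and_not_ssgd` combines
both halves into a criterion on `f`. -/

/-! ### Density of the polynomials in `L^p` of a Gaussian measure -/

/-- Dominated convergence in `L^q`. -/
lemma tendsto_eLpNorm_sub_of_dominated {α : Type*} [MeasurableSpace α] {μ : Measure α} {q : ℝ≥0∞}
    (hq0 : q ≠ 0) (hq : q ≠ ∞) {F : ℕ → α → ℝ} {f b : α → ℝ}
    (hF : ∀ n, AEStronglyMeasurable (F n) μ) (hf : AEStronglyMeasurable f μ) (hb : MemLp b q μ)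
    (hbound : ∀ n x, |F n x| ≤ b x) (hlim : ∀ x, Tendsto (fun n => F n x) atTop (𝓝 (f x))) :
    Tendsto (fun n => eLpNorm (fun x => F n x - f x) q μ) atTop (𝓝 0) := by
  have hq' : 0 < q.toReal := ENNReal.toReal_pos hq0 hq
  have hfb : ∀ x, |f x| ≤ b x := fun x =>
    le_of_tendsto ((continuous_abs.tendsto _).comp (hlim x)) (Eventually.of_forall fun n =>
      hbound n x)
  have key : Tendsto (fun n => ∫⁻ x, ‖F n x - f x‖ₑ ^ q.toReal ∂μ) atTop (𝓝 0) := by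
    have hb2 := (hb.const_mul 2).2
    have := tendsto_lintegral_of_dominated_convergence' (μ := μ)
      (F := fun n x => ‖F n x - f x‖ₑ ^ q.toReal) (f := fun _ => 0)
      (fun x => ‖2 * b x‖ₑ ^ q.toReal)
      (fun n => (((hF n).sub hf).enorm).pow_const _)
      (fun n => Eventually.of_forall fun x => by
        refine ENNReal.rpow_le_rpow ?_ hq'.le
        rw [enorm_le_iff_norm_le, Real.norm_eq_abs, Real.norm_eq_abs]
        have h1 := hbound n x
        have h2 := hfb x
        have h3 := abs_sub (F n x) (f x)
        have h4 := le_abs_self (2 * b x)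
        linarith)
      (by
        rw [eLpNorm_lt_top_iff_lintegral_rpow_enorm_lt_top hq0 hq] at hb2
        exact hb2.ne)
      (Eventually.of_forall fun x => by
        have h1 : Tendsto (fun n => F n x - f x) atTop (𝓝 0) := by
          simpa using (hlim x).sub_const (f x)
        have h2 := (h1.enorm).ennrpow_const q.toReal
        simpa [ENNReal.zero_rpow_of_pos hq'] using h2)
    simpa using this
  have h := key.ennrpow_const (1 / q.toReal)
  rw [ENNReal.zero_rpow_of_pos (by positivity)] at h
  refine h.congr fun n => ?_
  rw [eLpNorm_eq_lintegral_rpow_enorm_toReal hq0 hq]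

/-- The Taylor polynomials of the sine. -/
noncomputable def sinTaylor (n : ℕ) : Polynomial ℝ :=
  ∑ k ∈ Finset.range n,
    Polynomial.C ((-1) ^ k / ((2 * k + 1).factorial : ℝ)) * Polynomial.X ^ (2 * k + 1)

lemma eval_sinTaylor (n : ℕ) (x : ℝ) : (sinTaylor n).eval x
    = ∑ k ∈ Finset.range n, (-1) ^ k * x ^ (2 * k + 1) / ((2 * k + 1).factorial : ℝ) := by
  simp only [sinTaylor, Polynomial.eval_finsetSum, Polynomial.eval_mul, Polynomial.eval_C,
    Polynomial.eval_pow, Polynomial.eval_X]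
  exact Finset.sum_congr rfl fun k _ => by ring

lemma tendsto_eval_sinTaylor (x : ℝ) :
    Tendsto (fun n => (sinTaylor n).eval x) atTop (𝓝 (Real.sin x)) := by
  simp_rw [eval_sinTaylor]
  exact (Real.hasSum_sin x).tendsto_sum_nat

/-- In absolute value the terms are those of the series of `sinh |x|`, and `sinh ≤ exp`. The bound
does not depend on `n`, which is what dominated convergence needs. -/
lemma abs_eval_sinTaylor_le (n : ℕ) (x : ℝ) : |(sinTaylor n).eval x| ≤ Real.exp |x| := by
  rw [eval_sinTaylor]
  refine (Finset.abs_sum_le_sum_abs _ _).trans ?_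
  have h1 : ∑ k ∈ Finset.range n, |(-1) ^ k * x ^ (2 * k + 1) / ((2 * k + 1).factorial : ℝ)|
      ≤ Real.sinh |x| := by
    refine le_trans (le_of_eq ?_) (sum_le_hasSum (Finset.range n) (fun k _ => by positivity)
      (Real.hasSum_sinh |x|))
    refine Finset.sum_congr rfl fun k _ => ?_
    rw [abs_div, abs_mul, abs_pow, abs_pow, abs_neg, abs_one, one_pow, one_mul, Nat.abs_cast]
  have h2 := Real.cosh_add_sinh |x|
  have h3 := Real.cosh_pos |x|
  linarith

/-- The `q`-th power is at most `e^{cqx} + e^{-cqx}`, and Gaussian laws have all exponential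
moments. -/
lemma memLp_exp_mul_abs_gaussianReal {q : ℝ≥0∞} (hq : q ≠ ∞) (c : ℝ) (m : ℝ) (v : ℝ≥0) :
    MemLp (fun x : ℝ => Real.exp (c * |x|)) q (gaussianReal m v) := by
  rcases eq_or_ne q 0 with rfl | hq0
  · rw [memLp_zero_iff_aestronglyMeasurable]
    exact (by fun_prop : Continuous fun x : ℝ => Real.exp (c * |x|)).aestronglyMeasurable
  rw [← integrable_norm_rpow_iff
    (by fun_prop : Continuous fun x : ℝ => Real.exp (c * |x|)).aestronglyMeasurable hq0 hq]
  refine ((integrable_exp_mul_gaussianReal (μ := m) (v := v) (c * q.toReal)).add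
    (integrable_exp_mul_gaussianReal (μ := m) (v := v) (-(c * q.toReal)))).mono'
    ((by fun_prop : Measurable fun x : ℝ =>
      ‖Real.exp (c * |x|)‖ ^ q.toReal).aestronglyMeasurable) (Eventually.of_forall fun x => ?_)
  rw [Real.norm_of_nonneg (by positivity), Real.norm_of_nonneg (by positivity), ← Real.exp_mul,
    Pi.add_apply]
  rcases abs_cases x with ⟨h, _⟩ | ⟨h, _⟩ <;> rw [h]
  · rw [show c * x * q.toReal = c * q.toReal * x by ring]
    linarith [Real.exp_pos (-(c * q.toReal) * x)]
  · rw [show c * -x * q.toReal = -(c * q.toReal) * x by ring]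
    linarith [Real.exp_pos ((c * q.toReal) * x)]

lemma memLp_polynomial_gaussianReal {q : ℝ≥0∞} (hq : q ≠ ∞) (P : Polynomial ℝ) (m : ℝ) (v : ℝ≥0) :
    MemLp (fun x : ℝ => P.eval x) q (gaussianReal m v) := by
  have hb : MemLp (fun x : ℝ => ∑ i ∈ Finset.range (P.natDegree + 1),
      |P.coeff i| * Real.exp (i * |x|)) q (gaussianReal m v) :=
    memLp_finsetSum _ fun i _ => (memLp_exp_mul_abs_gaussianReal hq i m v).const_mul _
  refine hb.mono' P.continuous.aestronglyMeasurable (Eventually.of_forall fun x => ?_)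
  rw [Polynomial.eval_eq_sum_range]
  refine (norm_sum_le _ _).trans (Finset.sum_le_sum fun i _ => ?_)
  rw [norm_mul, norm_pow, Real.norm_eq_abs, Real.norm_eq_abs, Real.exp_nat_mul]
  gcongr
  linarith [Real.add_one_le_exp |x|]

/-- Polynomials of a sine are `L^q` limits of polynomials. -/
lemma exists_polynomial_near_comp_sin {q : ℝ≥0∞} (hq0 : q ≠ 0) (hq : q ≠ ∞) (m : ℝ) (v : ℝ≥0)
    (P : Polynomial ℝ) (c : ℝ) {δ : ℝ≥0∞} (hδ : 0 < δ) : ∃ Q : Polynomial ℝ,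
      eLpNorm (fun x => Q.eval x - P.eval (Real.sin (c * x))) q (gaussianReal m v) < δ := by
  let T : ℕ → Polynomial ℝ := fun n => P.comp ((sinTaylor n).comp (Polynomial.C c * Polynomial.X))
  have hT : ∀ n x, (T n).eval x = P.eval ((sinTaylor n).eval (c * x)) := by
    intro n x
    simp [T, Polynomial.eval_comp]
  -- Dominating function, monomial by monomial: the `i`-th power of a Taylor polynomial at `cx` is
  -- at most `e^{i|c||x|}`.
  have hb : MemLp (fun x : ℝ => ∑ i ∈ Finset.range (P.natDegree + 1),
      |P.coeff i| * Real.exp (i * |c| * |x|)) q (gaussianReal m v) :=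
    memLp_finsetSum _ fun i _ => (memLp_exp_mul_abs_gaussianReal hq (i * |c|) m v).const_mul _
  have hlim := tendsto_eLpNorm_sub_of_dominated hq0 hq (F := fun n x => (T n).eval x)
    (f := fun x => P.eval (Real.sin (c * x))) (fun n => (T n).continuous.aestronglyMeasurable)
    (P.continuous.comp (by fun_prop)).aestronglyMeasurable hb
    (fun n x => by
      rw [hT, Polynomial.eval_eq_sum_range]
      refine (Finset.abs_sum_le_sum_abs _ _).trans (Finset.sum_le_sum fun i _ => ?_)
      rw [abs_mul, abs_pow, mul_assoc, Real.exp_nat_mul, ← abs_mul]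
      gcongr
      exact abs_eval_sinTaylor_le n _)
    (fun x => by
      simp_rw [hT]
      exact (P.continuous.tendsto _).comp (tendsto_eval_sinTaylor (c * x)))
  obtain ⟨n, hn⟩ := (hlim.eventually_lt_const hδ).exists
  exact ⟨T n, hn⟩

/-- Bounded continuous functions are `L^q` limits of polynomials of sines. -/
lemma exists_comp_sin_near {q : ℝ≥0∞} (hq0 : q ≠ 0) (hq : q ≠ ∞) (μ : Measure ℝ)
    [IsFiniteMeasure μ] {g : ℝ → ℝ} (hg : Continuous g) {B : ℝ} (hB : ∀ x, |g x| ≤ B)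
    {δ : ℝ≥0∞} (hδ : 0 < δ) : ∃ (P : Polynomial ℝ) (c : ℝ),
      eLpNorm (fun x => P.eval (Real.sin (c * x)) - g x) q μ < δ := by
  -- Weierstrass on the compact range of the sine: with `s = sin (x / (n + 1))`, the function `g((n
  -- + 1) arcsin s)` equals `g x` as long as `|x| / (n + 1) < π / 2`, and stays bounded by `B` for
  -- all other `x`.
  have hP : ∀ n : ℕ, ∃ P : Polynomial ℝ, ∀ s ∈ Set.Icc (-1 : ℝ) 1,
      |P.eval s - g (Real.arcsin s * (n + 1))| < 1 / (n + 1) := fun n =>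
    exists_polynomial_near_of_continuousOn (-1) 1 _
      (by have := Real.continuous_arcsin; fun_prop) _ (by positivity)
  choose P hP using hP
  have hlim := tendsto_eLpNorm_sub_of_dominated (μ := μ) hq0 hq
    (F := fun n x => (P n).eval (Real.sin ((1 / (n + 1 : ℝ)) * x)))
    (f := g) (b := fun _ => B + 1)
    (fun n => ((P n).continuous.comp (by fun_prop)).aestronglyMeasurable)
    hg.aestronglyMeasurable (memLp_const _)
    (fun n x => by
      have h1 := hP n _ ⟨Real.neg_one_le_sin ((1 / (n + 1 : ℝ)) * x), Real.sin_le_one _⟩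
      have h2 := hB (Real.arcsin (Real.sin ((1 / (n + 1 : ℝ)) * x)) * (n + 1))
      have h3 : 1 / ((n : ℝ) + 1) ≤ 1 := by
        rw [div_le_one (by positivity)]; linarith [n.cast_nonneg (α := ℝ)]
      rw [abs_le] at h2 ⊢
      rw [abs_lt] at h1
      constructor <;> linarith)
    (fun x => by
      have hx : Tendsto (fun n : ℕ => (1 / (n + 1 : ℝ)) * x) atTop (𝓝 0) := by
        simpa using tendsto_one_div_add_atTop_nhds_zero_nat.mul_const x
      have hpi := Real.pi_pos
      -- For fixed `x` the arcsine eventually inverts the sine, and the error at `x` is then below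
      -- `1 / (n + 1)`.
      have hev : ∀ᶠ n : ℕ in atTop, (1 / (n + 1 : ℝ)) * x ∈ Set.Ioo (-(Real.pi / 2)) (Real.pi / 2) :=
        hx (Ioo_mem_nhds (by linarith) (by linarith))
      rw [tendsto_iff_norm_sub_tendsto_zero]
      refine squeeze_zero' (Eventually.of_forall fun _ => norm_nonneg _) ?_
        tendsto_one_div_add_atTop_nhds_zero_nat
      filter_upwards [hev] with n hn
      have h1 := hP n _ ⟨Real.neg_one_le_sin ((1 / (n + 1 : ℝ)) * x), Real.sin_le_one _⟩
      rw [Real.arcsin_sin hn.1.le hn.2.le, show (1 / (n + 1 : ℝ)) * x * (n + 1) = x by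
        field_simp] at h1
      exact h1.le)
  obtain ⟨n, hn⟩ := (hlim.eventually_lt_const hδ).exists
  exact ⟨P n, _, hn⟩

/-- Polynomials are dense in `L^q` of a Gaussian measure, `1 ≤ q < ∞`. -/
theorem exists_polynomial_eLpNorm_sub_lt {q : ℝ≥0∞} (hq1 : 1 ≤ q) (hq : q ≠ ∞) (m : ℝ) (v : ℝ≥0)
    {u : ℝ → ℝ} (hu : MemLp u q (gaussianReal m v)) {δ : ℝ≥0∞} (hδ : δ ≠ 0) :
    ∃ Q : Polynomial ℝ, eLpNorm (fun x => Q.eval x - u x) q (gaussianReal m v) < δ := by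
  have hq0 : q ≠ 0 := (zero_lt_one.trans_le hq1).ne'
  have h3 : 0 < δ / 3 := ENNReal.div_pos hδ (by norm_num)
  -- The infinite case is split off because the strict addition of the three errors below needs `δ /
  -- 3` finite.
  rcases eq_or_ne δ ∞ with rfl | hδt
  · exact ⟨0, ((memLp_polynomial_gaussianReal hq 0 m v).sub hu).2⟩
  obtain ⟨g, hg, -⟩ := hu.exists_boundedContinuous_eLpNorm_sub_le hq h3.ne'
  obtain ⟨P, c, hPc⟩ := exists_comp_sin_near hq0 hq (gaussianReal m v) g.continuous
    (fun x => g.norm_coe_le_norm x) h3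
  obtain ⟨Q, hQ⟩ := exists_polynomial_near_comp_sin hq0 hq m v P c h3
  refine ⟨Q, ?_⟩
  have hsm : AEStronglyMeasurable (fun x => P.eval (Real.sin (c * x))) (gaussianReal m v) :=
    (P.continuous.comp (by fun_prop)).aestronglyMeasurable
  have hg' : AEStronglyMeasurable (fun x => g x) (gaussianReal m v) :=
    g.continuous.aestronglyMeasurable
  have hQ' : AEStronglyMeasurable (fun x => Q.eval x) (gaussianReal m v) :=
    Q.continuous.aestronglyMeasurable
  have e : (fun x => Q.eval x - u x) = (fun x => Q.eval x - P.eval (Real.sin (c * x)))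
      + ((fun x => P.eval (Real.sin (c * x)) - g x) + fun x => g x - u x) := by
    ext x; simp
  rw [e]
  refine (eLpNorm_add_le (hQ'.sub hsm) ((hsm.sub hg').add (hg'.sub hu.1)) hq1).trans_lt ?_
  have hg2 : eLpNorm (fun x => g x - u x) q (gaussianReal m v) ≤ δ / 3 := by
    have e2 : (fun x => g x - u x) = fun x => -(u x - g x) := by ext x; ring
    rw [e2, show (fun x => -(u x - g x)) = -(u - ⇑g) from rfl, eLpNorm_neg]
    exact hg
  have h5 := (eLpNorm_add_le (hsm.sub hg') (hg'.sub hu.1) hq1).trans (add_le_add hPc.le hg2)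
  have h6 := ENNReal.add_lt_add_of_lt_of_le
    (ENNReal.add_ne_top.2 ⟨ENNReal.div_ne_top hδt (by norm_num),
      ENNReal.div_ne_top hδt (by norm_num)⟩ |> ne_top_of_le_ne_top <| h5) hQ h5
  refine h6.trans_le ?_
  rw [← add_assoc, ENNReal.add_thirds]

/-! ### A Hardy inequality for the Gaussian measure -/

lemma lintegral_gaussianReal_eq (m : ℝ) {v : ℝ≥0} (hv : v ≠ 0) (f : ℝ → ℝ≥0∞) :
    ∫⁻ x, f x ∂(gaussianReal m v) = ∫⁻ x, gaussianPDF m v x * f x := by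
  rw [gaussianReal_of_var_ne_zero m hv, lintegral_withDensity_eq_lintegral_mul_non_measurable]
  · simp
  · exact measurable_gaussianPDF m v
  · exact Eventually.of_forall fun x => gaussianPDF_lt_top

/-- For `t` between `0` and `x` one has `t² + (t - x)² ≤ x²`, so `e^{-x²/(2p)}` is at most
`e^{-(t-x)²/(2p)} e^{-t²/(2p)}`. The first factor is an unnormalized density of `N(x, p)`, whence
the constant `√(2πp)`. -/
lemma gaussianPDFReal_zero_one_rpow_le {p : ℝ≥0} (hp : p ≠ 0) {x t : ℝ}
    (ht : t ∈ Set.uIoc 0 x) :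
    gaussianPDFReal 0 1 x ^ (1 / (p : ℝ)) ≤ √(2 * Real.pi * p) *
      (gaussianPDFReal x p t * gaussianPDFReal 0 1 t ^ (1 / (p : ℝ))) := by
  have hp' : (0 : ℝ) < p := by positivity
  have hs : (0 : ℝ) < √(2 * Real.pi * p) := by positivity
  have hxt : t ^ 2 + (t - x) ^ 2 ≤ x ^ 2 := by
    rcases le_total 0 x with h | h
    · rw [Set.uIoc_of_le h] at ht
      nlinarith [mul_nonneg ht.1.le (sub_nonneg.2 ht.2)]
    · rw [Set.uIoc_of_ge h] at ht
      nlinarith [mul_nonneg_of_nonpos_of_nonpos ht.2 (sub_nonpos.2 ht.1.le)]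
  simp only [gaussianPDFReal, sub_zero, NNReal.coe_one, mul_one]
  rw [Real.mul_rpow (by positivity) (by positivity), Real.mul_rpow (by positivity) (by positivity),
    ← Real.exp_mul, ← Real.exp_mul]
  set K := (√(2 * Real.pi))⁻¹ ^ (1 / (p : ℝ)) with hK
  have hK0 : 0 ≤ K := by positivity
  rw [show √(2 * Real.pi * p) * ((√(2 * Real.pi * p))⁻¹ * Real.exp (-(t - x) ^ 2 / (2 * p)) *
      (K * Real.exp (-t ^ 2 / 2 * (1 / p)))) = K * (Real.exp (-(t - x) ^ 2 / (2 * p)) *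
      Real.exp (-t ^ 2 / 2 * (1 / p))) by field_simp, ← Real.exp_add]
  gcongr
  rw [show -x ^ 2 / 2 * (1 / (p : ℝ)) = -x ^ 2 / (2 * p) by field_simp,
    show -(t - x) ^ 2 / (2 * (p : ℝ)) + -t ^ 2 / 2 * (1 / p) = (-(t - x) ^ 2 - t ^ 2) / (2 * p) by
      field_simp; ring]
  gcongr
  linarith

/-- The `p`-th root of the density is the weight that turns `L^p(γ)` norms into Lebesgue `L^p`
norms. -/
lemma enorm_gaussianPDFReal_rpow_mul_rpow {p : ℝ≥0} (hp : p ≠ 0) (x y : ℝ) :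
    ‖gaussianPDFReal 0 1 x ^ (1 / (p : ℝ)) * y‖ₑ ^ (p : ℝ) = gaussianPDF 0 1 x * ‖y‖ₑ ^ (p : ℝ) := by
  have hp' : (0 : ℝ) < p := by positivity
  have h0 := gaussianPDFReal_nonneg 0 1 x
  rw [enorm_mul, ENNReal.mul_rpow_of_nonneg _ _ hp'.le,
    Real.enorm_of_nonneg (Real.rpow_nonneg h0 _),
    ENNReal.ofReal_rpow_of_nonneg (Real.rpow_nonneg h0 _) hp'.le, ← Real.rpow_mul h0,
    one_div_mul_cancel hp'.ne', Real.rpow_one]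
  rfl

/-- Jensen's inequality for `y ↦ y^p`, obtained from the monotonicity of `L^p` norms on a
probability space. -/
lemma lintegral_enorm_rpow_le {α : Type*} [MeasurableSpace α] (μ : Measure α)
    [IsProbabilityMeasure μ] {p : ℝ} (hp : 1 ≤ p) {f : α → ℝ} (hf : AEStronglyMeasurable f μ) :
    (∫⁻ x, ‖f x‖ₑ ∂μ) ^ p ≤ ∫⁻ x, ‖f x‖ₑ ^ p ∂μ := by
  have hp0 : 0 < p := by linarith
  have h := eLpNorm'_le_eLpNorm'_of_exponent_le zero_lt_one hp μ hf
  simp only [eLpNorm'_eq_lintegral_enorm, ENNReal.rpow_one, div_one] at h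
  have h2 := ENNReal.rpow_le_rpow h hp0.le
  rwa [← ENNReal.rpow_mul, one_div_mul_cancel hp0.ne', ENNReal.rpow_one] at h2

/-- Pointwise form of the Hardy inequality. The weighted primitive at `x` is at most `√(2πp)` times
the mean of the weighted `|u|` under `N(x, p)`; Jensen then moves the power inside. The exponent
lives in `ℝ≥0` because it is also the variance. -/
lemma gaussianPDF_mul_enorm_integral_le {p : ℝ≥0} (hp : 1 ≤ p) {u : ℝ → ℝ} (hu : Continuous u)
    (x : ℝ) : gaussianPDF 0 1 x * ‖∫ t in (0 : ℝ)..x, u t‖ₑ ^ (p : ℝ) ≤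
      ENNReal.ofReal √(2 * Real.pi * p) ^ (p : ℝ) *
        ∫⁻ t, gaussianPDF x p t * (gaussianPDF 0 1 t * ‖u t‖ₑ ^ (p : ℝ)) := by
  have hp0 : p ≠ 0 := (zero_lt_one.trans_le hp).ne'
  have hp' : (0 : ℝ) < p := by positivity
  set v : ℝ → ℝ := fun t => gaussianPDFReal 0 1 t ^ (1 / (p : ℝ)) * u t with hv
  have hvm : Measurable v := ((measurable_gaussianPDFReal 0 1).pow_const _).mul hu.measurable
  have h1 : ‖gaussianPDFReal 0 1 x ^ (1 / (p : ℝ)) * ∫ t in (0 : ℝ)..x, u t‖ₑ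
      ≤ ENNReal.ofReal √(2 * Real.pi * p) * ∫⁻ t, ‖v t‖ₑ ∂(gaussianReal x p) := by
    rw [lintegral_gaussianReal_eq x hp0,
      ← lintegral_const_mul _ (f := fun t => gaussianPDF x p t * ‖v t‖ₑ)
        ((measurable_gaussianPDF x p).mul hvm.enorm), ← intervalIntegral.integral_const_mul]
    have h2 : ‖∫ t in (0 : ℝ)..x, gaussianPDFReal 0 1 x ^ (1 / (p : ℝ)) * u t‖ₑ
        ≤ ∫⁻ t in Set.uIoc 0 x, ‖gaussianPDFReal 0 1 x ^ (1 / (p : ℝ)) * u t‖ₑ := by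
      rw [← ofReal_norm, intervalIntegral.norm_intervalIntegral_eq, ofReal_norm]
      exact enorm_integral_le_lintegral_enorm _
    refine h2.trans ((setLIntegral_mono (by fun_prop) fun t ht => ?_).trans
      (setLIntegral_le_lintegral (Set.uIoc 0 x) _))
    have h3 := gaussianPDFReal_zero_one_rpow_le hp0 ht
    have h4 := gaussianPDFReal_nonneg 0 1 x
    have h5 := gaussianPDFReal_nonneg 0 1 t
    have h6 := gaussianPDFReal_nonneg x p t
    rw [hv, enorm_mul, enorm_mul, Real.enorm_of_nonneg (Real.rpow_nonneg h4 _),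
      Real.enorm_of_nonneg (Real.rpow_nonneg h5 _), ← mul_assoc, ← mul_assoc, gaussianPDF,
      ← ENNReal.ofReal_mul (Real.sqrt_nonneg _),
      ← ENNReal.ofReal_mul (mul_nonneg (Real.sqrt_nonneg _) h6), mul_assoc √(2 * Real.pi * p)]
    gcongr
  have h7 := ENNReal.rpow_le_rpow h1 hp'.le
  rw [enorm_gaussianPDFReal_rpow_mul_rpow hp0, ENNReal.mul_rpow_of_nonneg _ _ hp'.le] at h7
  refine h7.trans ?_
  gcongr
  refine (lintegral_enorm_rpow_le _ (by exact_mod_cast hp) hvm.aestronglyMeasurable).trans ?_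
  rw [lintegral_gaussianReal_eq x hp0]
  simp_rw [hv, enorm_gaussianPDFReal_rpow_mul_rpow hp0]
  exact le_rfl

/-- The density is symmetric in its mean and its argument. -/
lemma lintegral_gaussianPDF_mean {p : ℝ≥0} (hp : p ≠ 0) (t : ℝ) :
    ∫⁻ x, gaussianPDF x p t = 1 := by
  rw [← lintegral_gaussianPDF_eq_one t hp]
  refine lintegral_congr fun x => ?_
  simp only [gaussianPDF, gaussianPDFReal]
  rw [show (t - x) ^ 2 = (x - t) ^ 2 by ring]

/-- The `L^p` norm of a primitive is controlled by that of the function. -/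
theorem lintegral_enorm_primitive_rpow_le {p : ℝ≥0} (hp : 1 ≤ p) {u : ℝ → ℝ} (hu : Continuous u) :
    ∫⁻ x, ‖∫ t in (0 : ℝ)..x, u t‖ₑ ^ (p : ℝ) ∂(gaussianReal 0 1) ≤
      ENNReal.ofReal √(2 * Real.pi * p) ^ (p : ℝ) *
        ∫⁻ t, ‖u t‖ₑ ^ (p : ℝ) ∂(gaussianReal 0 1) := by
  have hp0 : p ≠ 0 := (zero_lt_one.trans_le hp).ne'
  have hm : Measurable fun z : ℝ × ℝ => gaussianPDF z.1 p z.2 *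
      (gaussianPDF 0 1 z.2 * ‖u z.2‖ₑ ^ (p : ℝ)) := by
    have h1 : Measurable fun z : ℝ × ℝ => gaussianPDF z.1 p z.2 :=
      measurable_uncurry_gaussianPDF.comp (by fun_prop : Measurable fun z : ℝ × ℝ => (z.1, p, z.2))
    have h2 := measurable_gaussianPDF 0 1
    have h3 := hu.measurable
    fun_prop
  rw [lintegral_gaussianReal_eq 0 one_ne_zero, lintegral_gaussianReal_eq 0 one_ne_zero]
  refine (lintegral_mono fun x => gaussianPDF_mul_enorm_integral_le hp hu x).trans ?_
  -- By Tonelli the integral over the mean `x` comes first, and the kernel contributes a factor `1`.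
  rw [lintegral_const_mul _ hm.lintegral_prod_right', lintegral_lintegral_swap hm.aemeasurable]
  gcongr with t
  have ht : Measurable fun x : ℝ => gaussianPDF x p t := measurable_uncurry_gaussianPDF.comp
    (by fun_prop : Measurable fun x : ℝ => (x, p, t))
  dsimp only
  rw [lintegral_mul_const _ ht, lintegral_gaussianPDF_mean hp0, one_mul]

/-- Used twice: with `u = f'` to place `f` in `L^p`, and with `u` the error in approximating `f'` to
control the error in approximating `f`. -/
theorem eLpNorm_primitive_le {p : ℝ≥0} (hp : 1 ≤ p) {u : ℝ → ℝ} (hu : Continuous u) :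
    eLpNorm (fun x => ∫ t in (0 : ℝ)..x, u t) p (gaussianReal 0 1) ≤
      ENNReal.ofReal √(2 * Real.pi * p) * eLpNorm u p (gaussianReal 0 1) := by
  have hp' : (0 : ℝ) < p := by
    have : (0 : ℝ≥0) < p := zero_lt_one.trans_le hp
    exact_mod_cast this
  have hpe : (p : ℝ≥0∞) ≠ 0 := by simpa using (zero_lt_one.trans_le hp).ne'
  rw [eLpNorm_eq_lintegral_rpow_enorm_toReal hpe ENNReal.coe_ne_top,
    eLpNorm_eq_lintegral_rpow_enorm_toReal hpe ENNReal.coe_ne_top, ENNReal.coe_toReal]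
  have h := ENNReal.rpow_le_rpow (lintegral_enorm_primitive_rpow_le hp hu)
    (z := 1 / (p : ℝ)) (by positivity)
  rwa [ENNReal.mul_rpow_of_nonneg _ _ (by positivity), ← ENNReal.rpow_mul,
    mul_one_div_cancel hp'.ne', ENNReal.rpow_one] at h

/-- A `C¹` function with derivative in `L^p` belongs to `L^p`. -/
theorem memLp_of_memLp_deriv {p : ℝ≥0} (hp : 1 ≤ p) {f : ℝ → ℝ} (hf : ContDiff ℝ 1 f)
    (hf' : MemLp (deriv f) p (gaussianReal 0 1)) : MemLp f p (gaussianReal 0 1) := by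
  have hd : Continuous (deriv f) := hf.continuous_deriv le_rfl
  have h1 : MemLp (fun x => ∫ t in (0 : ℝ)..x, deriv f t) p (gaussianReal 0 1) :=
    ⟨(intervalIntegral.continuous_primitive (fun a b => hd.intervalIntegrable a b) 0).aestronglyMeasurable,
      (eLpNorm_primitive_le hp hd).trans_lt (ENNReal.mul_lt_top ENNReal.ofReal_lt_top hf'.2)⟩
  have e : f = fun x => (∫ t in (0 : ℝ)..x, deriv f t) + f 0 := by
    ext x
    rw [intervalIntegral.integral_deriv_eq_sub (fun y _ => hf.differentiable one_ne_zero y)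
      (hd.intervalIntegrable _ _)]
    ring
  rw [e]
  exact h1.add (memLp_const _)

/-! ### Polynomial approximation in the Gaussian Sobolev space -/

lemma exists_derivative_eq (Q : Polynomial ℝ) : ∃ R : Polynomial ℝ, R.derivative = Q := by
  induction Q using Polynomial.induction_on' with
  | add P Q hP hQ =>
    obtain ⟨R, rfl⟩ := hP
    obtain ⟨S, rfl⟩ := hQ
    exact ⟨R + S, by simp⟩
  | monomial n a =>
    refine ⟨Polynomial.monomial (n + 1) (a / (n + 1)), ?_⟩
    rw [Polynomial.derivative_monomial, Nat.add_sub_cancel]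
    congr 1
    push_cast
    field_simp

/-- Polynomials are dense in the Gaussian Sobolev space: a `C¹` function with derivative in `L^p`
is approximated together with its derivative. -/
theorem exists_polynomial_sobolev {p : ℝ≥0} (hp : 1 ≤ p) {f : ℝ → ℝ} (hf : ContDiff ℝ 1 f)
    (hf' : MemLp (deriv f) p (gaussianReal 0 1)) : ∃ P : ℕ → Polynomial ℝ,
      Tendsto (fun k => eLpNorm (fun x => (P k).eval x - f x) p (gaussianReal 0 1)) atTop (𝓝 0) ∧
      Tendsto (fun k => eLpNorm (fun x => (P k).derivative.eval x - deriv f x) p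
        (gaussianReal 0 1)) atTop (𝓝 0) := by
  have hd : Continuous (deriv f) := hf.continuous_deriv le_rfl
  have hQ : ∀ k : ℕ, ∃ Q : Polynomial ℝ,
      eLpNorm (fun x => Q.eval x - deriv f x) p (gaussianReal 0 1) < (k : ℝ≥0∞)⁻¹ := fun k =>
    exists_polynomial_eLpNorm_sub_lt (by exact_mod_cast hp) ENNReal.coe_ne_top 0 1 hf'
      (ENNReal.inv_ne_zero.2 (ENNReal.natCast_ne_top k))
  choose Q hQ using hQ
  have hQ0 : Tendsto (fun k => eLpNorm (fun x => (Q k).eval x - deriv f x) p (gaussianReal 0 1))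
      atTop (𝓝 0) :=
    tendsto_of_tendsto_of_tendsto_of_le_of_le tendsto_const_nhds
      ENNReal.tendsto_inv_nat_nhds_zero (fun _ => zero_le) fun k => (hQ k).le
  -- Matching the values at `0` makes `P k - f` exactly the primitive from `0` of `Q k - f'`.
  have hprim : ∀ k, ∃ P : Polynomial ℝ, P.derivative = Q k ∧ P.eval 0 = f 0 := by
    intro k
    obtain ⟨R, hR⟩ := exists_derivative_eq (Q k)
    refine ⟨R + Polynomial.C (f 0 - R.eval 0), ?_, ?_⟩ <;> simp [hR]
  choose P hP hP0 using hprim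
  refine ⟨P, ?_, by simpa only [hP] using hQ0⟩
  have hbound : ∀ k, eLpNorm (fun x => (P k).eval x - f x) p (gaussianReal 0 1) ≤
      ENNReal.ofReal √(2 * Real.pi * p) *
        eLpNorm (fun x => (Q k).eval x - deriv f x) p (gaussianReal 0 1) := by
    intro k
    convert eLpNorm_primitive_le hp (u := fun x => (Q k).eval x - deriv f x)
      ((Q k).continuous.sub hd) using 2
    ext x
    rw [intervalIntegral.integral_sub ((Q k).continuous.intervalIntegrable _ _)
      (hd.intervalIntegrable _ _), intervalIntegral.integral_deriv_eq_sub
        (fun y _ => hf.differentiable one_ne_zero y) (hd.intervalIntegrable _ _),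
      intervalIntegral.integral_eq_sub_of_hasDerivAt (f := fun y => (P k).eval y)
        (fun y _ => by simpa only [hP] using (P k).hasDerivAt y)
        ((Q k).continuous.intervalIntegrable _ _), hP0]
    ring
  refine tendsto_of_tendsto_of_tendsto_of_le_of_le tendsto_const_nhds ?_ (fun _ => zero_le) hbound
  have h := ENNReal.Tendsto.const_mul (a := ENNReal.ofReal √(2 * Real.pi * p)) hQ0
    (Or.inr ENNReal.ofReal_ne_top)
  rwa [mul_zero] at h

/-! ### Functions of the endpoint of the path -/

/-- The endpoint is the increment over `[0,1]`, since paths start at `0`. -/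
lemma measurePreserving_eval_one :
    MeasurePreserving (fun ω : PathSpace => ω 1) wienerMeasure (gaussianReal 0 1) := by
  have h := isWienerMeasure_wienerMeasure.law_increment 0 1 zero_le_one
  simp only [map_zero, sub_zero, Set.Icc.coe_one, Set.Icc.coe_zero, Real.toNNReal_one] at h
  exact ⟨(continuous_eval_const (1 : I)).measurable, h.map_eq⟩

lemma unitDirection_ae_eq :
    unitDirection =ᵐ[volume.restrict (Set.Icc (0 : ℝ) 1)] fun _ => (1 : ℝ) :=
  MemLp.coeFn_toLp _

lemma cameronMartinPath_unitDirection_one : cameronMartinPath unitDirection 1 = 1 := by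
  change ∫ x in (0 : ℝ)..((1 : I) : ℝ), unitDirection x = 1
  rw [Set.Icc.coe_one, intervalIntegral.integral_of_le zero_le_one,
    integral_congr_ae (ae_mono (Measure.restrict_mono Set.Ioc_subset_Icc_self le_rfl)
      unitDirection_ae_eq)]
  simp

/-- For functionals of the endpoint, the shift of the path becomes a translation of the real line.
-/
lemma shift_smul_unitDirection_one (ε : ℝ) (ω : PathSpace) :
    shift (ε • unitDirection) ω 1 = ω 1 + ε := by
  simp [shift, cameronMartinPath_unitDirection_one]

/-- The endpoint of the path is the Wiener integral of the constant density `1`. -/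
lemma isWienerIntegral_eval_one : IsWienerIntegral unitDirection fun ω => ω 1 := by
  -- The constant sequence `1_{(0,1]}`: it differs from the density `1` only at the point `0`, and
  -- its elementary integral is already `ω 1`.
  refine ⟨?_, fun _ => ⟨1, fun _ => 1, fun _ => 0, fun _ => 1, fun _ => zero_le_one⟩, ?_, ?_⟩
  · exact (memLp_id_gaussianReal (μ := 0) (v := 1) 2).comp_measurePreserving
      measurePreserving_eval_one
  · refine tendsto_const_nhds.congr fun _ => ?_
    symm
    rw [eLpNorm_congr_ae (g := 0), eLpNorm_zero]
    have h0 : ∀ᵐ x ∂(volume.restrict (Set.Icc (0 : ℝ) 1)), x ∈ Set.Ioc (0 : ℝ) 1 := by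
      rw [← Measure.restrict_congr_set Ioc_ae_eq_Icc]
      exact ae_restrict_mem measurableSet_Ioc
    filter_upwards [unitDirection_ae_eq, h0] with x hx hx0
    simp [StepFunction.toFun, hx, Set.indicator_of_mem hx0]
  · simp [StepFunction.wienerIntegral]

/-- The polynomial cylindrical functional `P(W₁)`. -/
noncomputable def endpointCylinder (P : Polynomial ℝ) : PolynomialCylinder where
  n := 1
  h := fun _ => unitDirection
  X := fun _ ω => ω 1
  isWienerIntegral := fun _ => isWienerIntegral_eval_one
  f := P.toMvPolynomial 0

lemma endpointCylinder_val (P : Polynomial ℝ) (ω : PathSpace) :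
    (endpointCylinder P).val ω = P.eval (ω 1) :=
  MvPolynomial.eval_toMvPolynomial _ _ _

lemma pderiv_toMvPolynomial (P : Polynomial ℝ) :
    MvPolynomial.pderiv (0 : Fin 1) (P.toMvPolynomial 0) = P.derivative.toMvPolynomial 0 := by
  induction P using Polynomial.induction_on' with
  | add P Q hP hQ => simp [hP, hQ]
  | monomial n a =>
    rw [Polynomial.derivative_monomial, ← Polynomial.C_mul_X_pow_eq_monomial,
      ← Polynomial.C_mul_X_pow_eq_monomial]
    simp [mul_assoc]

lemma endpointCylinder_grad (P : Polynomial ℝ) (ω : PathSpace) :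
    (endpointCylinder P).grad ω = P.derivative.eval (ω 1) • unitDirection := by
  change ∑ i : Fin 1, MvPolynomial.eval (fun _ : Fin 1 => ω 1)
    (MvPolynomial.pderiv i (P.toMvPolynomial 0)) • unitDirection = _
  rw [Fin.sum_univ_one, pderiv_toMvPolynomial, MvPolynomial.eval_toMvPolynomial]

lemma eLpNorm_eval_one {q : ℝ≥0∞} (φ : ℝ → ℝ) (hφ : Continuous φ) :
    eLpNorm (fun ω : PathSpace => φ (ω 1)) q wienerMeasure = eLpNorm φ q (gaussianReal 0 1) :=
  eLpNorm_comp_measurePreserving hφ.aestronglyMeasurable measurePreserving_eval_one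

/-- All gradients involved are multiples of one fixed vector, so convergence in `L^p(H)` follows
from that of the scalar factors. -/
lemma eLpNorm_smul_const_le {α E : Type*} [MeasurableSpace α] (μ : Measure α)
    [NormedAddCommGroup E] [NormedSpace ℝ E] (q : ℝ≥0∞) (φ : α → ℝ) (e : E) :
    eLpNorm (fun x => φ x • e) q μ ≤ eLpNorm φ q μ * ‖e‖ₑ := by
  refine (eLpNorm_le_nnreal_smul_eLpNorm_of_ae_le_mul (g := φ) (c := ‖e‖₊)
    (Eventually.of_forall fun x => by rw [nnnorm_smul, mul_comm]) q).trans (le_of_eq ?_)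
  rw [mul_comm]
  rfl

/-- `f(W₁)` is Malliavin differentiable if `f` is `C¹` with derivative in `L^p` of the Gaussian
measure. -/
theorem memMalliavinSobolev_eval_one {p : ℝ} (hp : 1 ≤ p) {f : ℝ → ℝ} (hf : ContDiff ℝ 1 f)
    (hf' : MemLp (deriv f) (ENNReal.ofReal p) (gaussianReal 0 1)) :
    MemMalliavinSobolev p fun ω => f (ω 1) := by
  have hp' : 1 ≤ p.toNNReal := by simpa using hp
  have hd : Continuous (deriv f) := hf.continuous_deriv le_rfl
  have hE := measurePreserving_eval_one
  obtain ⟨P, hP, hP'⟩ := exists_polynomial_sobolev hp' hf hf'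
  rw [show ((p.toNNReal : ℝ≥0) : ℝ≥0∞) = ENNReal.ofReal p from rfl] at hP hP'
  refine ⟨fun ω => deriv f (ω 1) • unitDirection,
    (memLp_of_memLp_deriv hp' hf hf').comp_measurePreserving hE, ?_,
    fun k => endpointCylinder (P k), ?_, ?_⟩
  · have h1 : MemLp (fun ω : PathSpace => deriv f (ω 1)) (ENNReal.ofReal p) wienerMeasure :=
      hf'.comp_measurePreserving hE
    refine (h1.norm.mul_const ‖unitDirection‖).mono' (h1.1.smul_const _)
      (Eventually.of_forall fun ω => (norm_smul _ _).le)
  · refine hP.congr fun k => ?_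
    simp_rw [endpointCylinder_val]
    exact (eLpNorm_eval_one _ ((P k).continuous.sub hf.continuous)).symm
  · have h2 := ENNReal.Tendsto.mul_const (b := ‖unitDirection‖ₑ) hP'
      (Or.inr enorm_ne_top)
    rw [zero_mul] at h2
    refine tendsto_of_tendsto_of_tendsto_of_le_of_le tendsto_const_nhds h2 (fun _ => zero_le)
      fun k => ?_
    rw [← eLpNorm_eval_one (fun x => (P k).derivative.eval x - deriv f x)
      ((P k).derivative.continuous.sub hd)]
    simp_rw [endpointCylinder_grad, ← sub_smul]
    exact eLpNorm_smul_const_le _ _ _ _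

/-! ### Difference quotients with infinite moments -/

/-- If the quotient had a finite `p`-th moment, then `f(x + ε) = ε · quotient + f(x)` would be in
`L^p`. -/
lemma lintegral_diffQuotient_eq_top {p : ℝ} (hp : 1 ≤ p) {f : ℝ → ℝ} (hf : Continuous f)
    (hfp : MemLp f (ENNReal.ofReal p) (gaussianReal 0 1)) {ε : ℝ} (hε : ε ≠ 0)
    (htop : ∫⁻ x, ‖f (x + ε)‖ₑ ^ p ∂(gaussianReal 0 1) = ∞) :
    ∫⁻ ω, ‖diffQuotient (fun ω => f (ω 1)) unitDirection ε ω‖ₑ ^ p ∂wienerMeasure = ∞ := by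
  have hp0 : 0 < p := by linarith
  have hE := measurePreserving_eval_one
  have hc : Continuous fun x => (f (x + ε) - f x) / ε := by fun_prop
  have hq : ∀ ω : PathSpace, diffQuotient (fun ω => f (ω 1)) unitDirection ε ω
      = (f (ω 1 + ε) - f (ω 1)) / ε := fun ω => by
    rw [diffQuotient, shift_smul_unitDirection_one]
  simp_rw [hq]
  rw [hE.lintegral_comp (f := fun x => ‖(f (x + ε) - f x) / ε‖ₑ ^ p) (by fun_prop)]
  by_contra hne
  have hpe : ENNReal.ofReal p ≠ 0 := by simpa using hp0
  have h1 : MemLp (fun x => (f (x + ε) - f x) / ε) (ENNReal.ofReal p) (gaussianReal 0 1) := by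
    refine ⟨hc.aestronglyMeasurable, ?_⟩
    rw [eLpNorm_lt_top_iff_lintegral_rpow_enorm_lt_top hpe ENNReal.ofReal_ne_top,
      ENNReal.toReal_ofReal hp0.le]
    exact lt_top_iff_ne_top.2 hne
  have h2 : MemLp (fun x => f (x + ε)) (ENNReal.ofReal p) (gaussianReal 0 1) := by
    refine ((h1.const_mul ε).add hfp).ae_eq (Eventually.of_forall fun x => ?_)
    simp only [Pi.add_apply]
    field_simp
    ring
  have h3 := h2.2
  rw [eLpNorm_lt_top_iff_lintegral_rpow_enorm_lt_top hpe ENNReal.ofReal_ne_top,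
    ENNReal.toReal_ofReal hp0.le, htop] at h3
  exact lt_irrefl _ h3

/-- Convergence would put the quotient at finite `L^p` distance from `⟨D, h⟩`, itself in `L^p`, for
some `ε > 0`. A single direction `h` suffices. -/
lemma not_ssgd_of_lintegral_diffQuotient_eq_top {p : ℝ} (hp : 1 ≤ p) {Z : PathSpace → ℝ}
    {h : CameronMartin} (hZ : ∀ ε, AEStronglyMeasurable (diffQuotient Z h ε) wienerMeasure)
    (htop : ∀ ε, 0 < ε → ∫⁻ ω, ‖diffQuotient Z h ε ω‖ₑ ^ p ∂wienerMeasure = ∞) :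
    ¬ SSGD p p Z := by
  rintro ⟨-, D, hD, hlim⟩
  have hp0 : 0 < p := by linarith
  have hpe : ENNReal.ofReal p ≠ 0 := by simpa using hp0
  obtain ⟨ε, hlt, hε⟩ := (((hlim h).eventually_lt_const zero_lt_one).and
    self_mem_nhdsWithin).exists
  have hDh : MemLp (fun ω => inner ℝ (D ω) h) (ENNReal.ofReal p) wienerMeasure :=
    hD.inner_const h
  have h1 : MemLp (fun ω => diffQuotient Z h ε ω - inner ℝ (D ω) h) (ENNReal.ofReal p)
      wienerMeasure := by
    refine ⟨(hZ ε).sub hDh.1, ?_⟩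
    rw [eLpNorm_lt_top_iff_lintegral_rpow_enorm_lt_top hpe ENNReal.ofReal_ne_top,
      ENNReal.toReal_ofReal hp0.le]
    exact hlt.trans ENNReal.one_lt_top
  have h2 := (h1.add hDh).2
  rw [eLpNorm_lt_top_iff_lintegral_rpow_enorm_lt_top hpe ENNReal.ofReal_ne_top,
    ENNReal.toReal_ofReal hp0.le] at h2
  simp only [Pi.add_apply, sub_add_cancel] at h2
  rw [htop ε hε] at h2
  exact lt_irrefl _ h2

/-- A function that grows like `e^{x²/(2p)}`, up to powers of `x`, is in no `L^p` after a shift to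
the left. -/
lemma lintegral_shift_eq_top {p : ℝ} (hp : 0 < p) {f : ℝ → ℝ} {c b x₀ : ℝ} (hc : 0 < c)
    (hf : ∀ x, x₀ ≤ x → c * (Real.exp (x ^ 2 / (2 * p)) * x ^ (-b)) ≤ f x) {ε : ℝ} (hε : 0 < ε) :
    ∫⁻ x, ‖f (x + ε)‖ₑ ^ p ∂(gaussianReal 0 1) = ∞ := by
  set K := (√(2 * Real.pi))⁻¹ * (c ^ p * Real.exp (-ε ^ 2 / 2)) with hK
  have hK0 : 0 < K := by positivity
  -- With `y = x + ε`, density times `|f y|^p` is at least `K e^{εy} / y^{bp}`, because `y²/2 - x²/2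
  -- = εy - ε²/2`. This tends to infinity.
  have hlim := tendsto_exp_mul_div_rpow_atTop (b * p) ε hε
  obtain ⟨X, hX⟩ := eventually_atTop.1 (hlim.eventually_ge_atTop (1 / K))
  set Y := max (max X x₀) 1 with hY
  -- An integrand at least `1` on a half-line already has infinite integral.
  have hlow : ∀ x ∈ Set.Ici Y, 1 ≤ gaussianPDF 0 1 x * ‖f (x + ε)‖ₑ ^ p := by
    intro x hx
    have hx1 : Y ≤ x := hx
    have hYX : X ≤ Y := (le_max_left _ _).trans (le_max_left _ _)
    have hYx : x₀ ≤ Y := (le_max_right _ _).trans (le_max_left _ _)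
    have hY1 : 1 ≤ Y := le_max_right _ _
    have hy0 : 0 < x + ε := by linarith
    have h1 := hf (x + ε) (by linarith)
    have h2 := hX (x + ε) (by linarith)
    have hf0 : 0 ≤ f (x + ε) := le_trans (by positivity) h1
    have h3 : (c * (Real.exp ((x + ε) ^ 2 / (2 * p)) * (x + ε) ^ (-b))) ^ p ≤ f (x + ε) ^ p :=
      Real.rpow_le_rpow (by positivity) h1 hp.le
    rw [Real.mul_rpow hc.le (by positivity), Real.mul_rpow (by positivity) (by positivity),
      ← Real.exp_mul, ← Real.rpow_mul hy0.le] at h3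
    rw [Real.enorm_of_nonneg hf0, ENNReal.ofReal_rpow_of_nonneg hf0 hp.le, gaussianPDF,
      ← ENNReal.ofReal_mul (gaussianPDFReal_nonneg _ _ _), ENNReal.one_le_ofReal]
    have h4 : 1 ≤ K * (Real.exp (ε * (x + ε)) / (x + ε) ^ (b * p)) := by
      rw [div_le_iff₀' hK0] at h2
      exact h2
    refine h4.trans ((le_of_eq ?_).trans (mul_le_mul_of_nonneg_left h3
      (gaussianPDFReal_nonneg 0 1 x)))
    rw [neg_mul, Real.rpow_neg hy0.le, gaussianPDFReal, hK, NNReal.coe_one, mul_one, sub_zero]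
    have h5 : Real.exp (-ε ^ 2 / 2) * Real.exp (ε * (x + ε))
        = Real.exp (-x ^ 2 / (2 * 1)) * Real.exp ((x + ε) ^ 2 / (2 * p) * p) := by
      rw [← Real.exp_add, ← Real.exp_add]
      congr 1
      field_simp
      ring
    calc _ = (√(2 * Real.pi))⁻¹ * c ^ p * ((x + ε) ^ (b * p))⁻¹ *
          (Real.exp (-ε ^ 2 / 2) * Real.exp (ε * (x + ε))) := by ring
      _ = _ := by rw [h5]; ring
  rw [lintegral_gaussianReal_eq 0 one_ne_zero, eq_top_iff]
  calc (∞ : ℝ≥0∞) = ∫⁻ _ in Set.Ici Y, 1 := by simp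
    _ ≤ ∫⁻ x in Set.Ici Y, gaussianPDF 0 1 x * ‖f (x + ε)‖ₑ ^ p :=
        setLIntegral_mono' measurableSet_Ici hlow
    _ ≤ _ := setLIntegral_le_lintegral _ _

/-- The `p`-th power of `e^{x²/(2p)}` times the Gaussian density is the constant `(2π)^{-1/2}`, so
integrability under `γ` reduces to Lebesgue integrability of `|w|^p`. -/
lemma memLp_exp_sq_mul {p : ℝ} (hp : 0 < p) {w : ℝ → ℝ} (hw : MemLp w (ENNReal.ofReal p)) :
    MemLp (fun x => Real.exp (x ^ 2 / (2 * p)) * w x) (ENNReal.ofReal p) (gaussianReal 0 1) := by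
  have hpe : ENNReal.ofReal p ≠ 0 := by simpa using hp
  have hexp : Continuous fun x : ℝ => Real.exp (x ^ 2 / (2 * p)) := by fun_prop
  refine ⟨hexp.aestronglyMeasurable.mul
    (hw.1.mono_ac (gaussianReal_absolutelyContinuous 0 one_ne_zero)), ?_⟩
  have h := hw.2
  rw [eLpNorm_lt_top_iff_lintegral_rpow_enorm_lt_top hpe ENNReal.ofReal_ne_top,
    ENNReal.toReal_ofReal hp.le] at h ⊢
  rw [lintegral_gaussianReal_eq 0 one_ne_zero]
  have e : ∀ x, gaussianPDF 0 1 x * ‖Real.exp (x ^ 2 / (2 * p)) * w x‖ₑ ^ p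
      = ENNReal.ofReal (√(2 * Real.pi))⁻¹ * ‖w x‖ₑ ^ p := by
    intro x
    rw [enorm_mul, ENNReal.mul_rpow_of_nonneg _ _ hp.le, Real.enorm_of_nonneg (by positivity),
      ENNReal.ofReal_rpow_of_nonneg (by positivity) hp.le, gaussianPDF, ← mul_assoc,
      ← ENNReal.ofReal_mul (gaussianPDFReal_nonneg _ _ _), ← Real.exp_mul, gaussianPDFReal,
      mul_assoc (√(2 * Real.pi * (1 : ℝ≥0)))⁻¹, ← Real.exp_add]
    congr 2
    rw [NNReal.coe_one, show -(x - 0) ^ 2 / (2 * 1) + x ^ 2 / (2 * p) * p = 0 by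
      field_simp; ring]
    simp
  simp_rw [e]
  rw [lintegral_const_mul' _ _ ENNReal.ofReal_ne_top]
  exact ENNReal.mul_lt_top ENNReal.ofReal_lt_top h

/-- A `C¹` function `f` with derivative in `L^p` that grows like `e^{x²/(2p)}`, up to powers of `x`,
gives a Malliavin differentiable functional `f(W₁)` whose difference quotients have no `p`-th
moment. -/
theorem sobolev_and_not_ssgd {p : ℝ} (hp : 1 ≤ p) {f : ℝ → ℝ} (hf : ContDiff ℝ 1 f)
    (hf' : MemLp (deriv f) (ENNReal.ofReal p) (gaussianReal 0 1)) {c b x₀ : ℝ} (hc : 0 < c)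
    (hlow : ∀ x, x₀ ≤ x → c * (Real.exp (x ^ 2 / (2 * p)) * x ^ (-b)) ≤ f x) :
    MemMalliavinSobolev p (fun ω => f (ω 1)) ∧ ¬ SSGD p p (fun ω => f (ω 1)) ∧
      ∀ ε : ℝ, 0 < ε → ∫⁻ ω, ‖diffQuotient (fun ω => f (ω 1)) unitDirection ε ω‖ₑ ^ p
        ∂wienerMeasure = ∞ := by
  have hp' : 1 ≤ p.toNNReal := by simpa using hp
  have htop : ∀ ε : ℝ, 0 < ε → ∫⁻ ω, ‖diffQuotient (fun ω => f (ω 1)) unitDirection ε ω‖ₑ ^ p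
      ∂wienerMeasure = ∞ := fun ε hε =>
    lintegral_diffQuotient_eq_top hp hf.continuous (memLp_of_memLp_deriv hp' hf hf') hε.ne'
      (lintegral_shift_eq_top (by linarith) hc hlow hε)
  refine ⟨memMalliavinSobolev_eval_one hp hf hf',
    not_ssgd_of_lintegral_diffQuotient_eq_top hp (fun ε => ?_) htop, htop⟩
  have hq : diffQuotient (fun ω => f (ω 1)) unitDirection ε
      = (fun x => (f (x + ε) - f x) / ε) ∘ fun ω : PathSpace => ω 1 := by
    ext ω
    rw [diffQuotient, shift_smul_unitDirection_one, Function.comp_apply]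
  rw [hq]
  have hfc := hf.continuous
  exact (by fun_prop : Measurable fun x => (f (x + ε) - f x) / ε).aestronglyMeasurable.comp_measurePreserving
    measurePreserving_eval_one

/-! ### The two examples -/

/-- The function `e^{x²/(2p)} (1+x²)^{-2}`. -/
noncomputable def gaussGrowth (p x : ℝ) : ℝ := Real.exp (x ^ 2 / (2 * p)) * ((1 + x ^ 2) ^ 2)⁻¹

lemma contDiff_gaussGrowth (p : ℝ) : ContDiff ℝ 1 (gaussGrowth p) := by
  unfold gaussGrowth
  refine ContDiff.mul (by fun_prop) (ContDiff.inv (by fun_prop) fun x => by positivity)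

/-- Differentiating the exponential costs a factor `x / p`, absorbed by one of the two factors `(1 +
x²)⁻¹`. The constant is `1` from this term plus `4` from differentiating the rational factor. -/
lemma abs_deriv_gaussGrowth_le {p : ℝ} (hp : 1 ≤ p) (x : ℝ) :
    |deriv (gaussGrowth p) x| ≤ 5 * (Real.exp (x ^ 2 / (2 * p)) * (1 + x ^ 2)⁻¹) := by
  have hp0 : 0 < p := by linarith
  have h1 : HasDerivAt (fun x : ℝ => x ^ 2 / (2 * p)) (x / p) x := by
    refine ((hasDerivAt_pow 2 x).div_const (2 * p)).congr_deriv ?_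
    field_simp
    simp
  have h2 : HasDerivAt (fun x : ℝ => (1 + x ^ 2) ^ 2) (4 * x * (1 + x ^ 2)) x := by
    refine (((hasDerivAt_pow 2 x).const_add 1).pow 2).congr_deriv ?_
    simp
    ring
  have h3 : HasDerivAt (gaussGrowth p) _ x := h1.exp.mul (h2.inv (by positivity))
  rw [h3.deriv]
  have e : Real.exp (x ^ 2 / (2 * p)) * (x / p) * ((1 + x ^ 2) ^ 2)⁻¹ +
      Real.exp (x ^ 2 / (2 * p)) * (-(4 * x * (1 + x ^ 2)) / ((1 + x ^ 2) ^ 2) ^ 2)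
      = Real.exp (x ^ 2 / (2 * p)) * (1 + x ^ 2)⁻¹ *
        (x / (1 + x ^ 2) / p - 4 * x / (1 + x ^ 2) ^ 2) := by
    field_simp
    ring
  rw [e, abs_mul, abs_of_nonneg (a := Real.exp (x ^ 2 / (2 * p)) * (1 + x ^ 2)⁻¹) (by positivity),
    mul_comm 5]
  gcongr
  have hx : |x| ≤ 1 + x ^ 2 := by
    rw [abs_le]
    constructor <;> nlinarith [sq_nonneg (x - 1), sq_nonneg (x + 1)]
  have h4 : |x / (1 + x ^ 2) / p| ≤ 1 := by
    rw [abs_div, abs_div, abs_of_pos hp0, abs_of_pos (a := 1 + x ^ 2) (by positivity)]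
    exact div_le_one_of_le₀ ((div_le_one_of_le₀ hx (by positivity)).trans hp) hp0.le
  have h5 : |4 * x / (1 + x ^ 2) ^ 2| ≤ 4 := by
    rw [abs_div, abs_mul, abs_of_pos (a := (1 + x ^ 2) ^ 2) (by positivity),
      abs_of_pos (a := (4 : ℝ)) (by norm_num), div_le_iff₀ (by positivity)]
    nlinarith [sq_nonneg x, sq_nonneg (x ^ 2)]
  calc _ ≤ |x / (1 + x ^ 2) / p| + |4 * x / (1 + x ^ 2) ^ 2| := abs_sub _ _
    _ ≤ 5 := by linarith

/-- The base is at most `1`, so its `p`-th power is at most the integrable function itself. -/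
lemma memLp_inv_one_add_sq {p : ℝ} (hp : 1 ≤ p) :
    MemLp (fun x : ℝ => (1 + x ^ 2)⁻¹) (ENNReal.ofReal p) := by
  have hc : Continuous fun x : ℝ => (1 + x ^ 2)⁻¹ :=
    Continuous.inv₀ (by fun_prop) fun x => by positivity
  rw [← integrable_norm_rpow_iff hc.aestronglyMeasurable (by simpa using by linarith)
    ENNReal.ofReal_ne_top, ENNReal.toReal_ofReal (by linarith)]
  refine integrable_inv_one_add_sq.mono'
    (hc.norm.rpow_const fun x => Or.inr (by linarith)).aestronglyMeasurable
    (Eventually.of_forall fun x => ?_)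
  have h0 : 0 < (1 + x ^ 2)⁻¹ := by positivity
  have h1 : (1 + x ^ 2)⁻¹ ≤ 1 := inv_le_one_of_one_le₀ (by nlinarith)
  rw [Real.norm_of_nonneg h0.le, Real.norm_of_nonneg (by positivity)]
  calc (1 + x ^ 2)⁻¹ ^ p ≤ (1 + x ^ 2)⁻¹ ^ (1 : ℝ) := Real.rpow_le_rpow_of_exponent_ge h0 h1 hp
    _ = _ := Real.rpow_one _

lemma memLp_deriv_gaussGrowth {p : ℝ} (hp : 1 ≤ p) :
    MemLp (deriv (gaussGrowth p)) (ENNReal.ofReal p) (gaussianReal 0 1) :=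
  ((memLp_exp_sq_mul (by linarith) (memLp_inv_one_add_sq hp)).const_mul 5).mono'
    ((contDiff_gaussGrowth p).continuous_deriv le_rfl).aestronglyMeasurable
    (Eventually.of_forall (abs_deriv_gaussGrowth_le hp))

/-- For `x ≥ 1`, `1 + x² ≤ 2x²`, hence `(1 + x²)² ≤ 4x⁴`: the growth criterion holds with `c = 1/4`
and `b = 4`. -/
lemma le_gaussGrowth (p : ℝ) {x : ℝ} (hx : 1 ≤ x) :
    1 / 4 * (Real.exp (x ^ 2 / (2 * p)) * x ^ (-(4 : ℝ))) ≤ gaussGrowth p x := by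
  rw [gaussGrowth, show 1 / 4 * (Real.exp (x ^ 2 / (2 * p)) * x ^ (-(4 : ℝ)))
    = Real.exp (x ^ 2 / (2 * p)) * (1 / 4 * x ^ (-(4 : ℝ))) by ring]
  gcongr
  rw [Real.rpow_neg (by linarith), show (4 : ℝ) = ((4 : ℕ) : ℝ) by norm_num, Real.rpow_natCast,
    one_div, ← mul_inv]
  refine inv_anti₀ (by positivity) ?_
  push_cast
  nlinarith [one_le_pow₀ hx (n := 2), sq_nonneg (x ^ 2 - 1)]

/-! ### The explicit example for `p = 2` -/

lemma hasDerivAt_exp_sq_mul_rpow (a k : ℝ) {x : ℝ} (hx : 0 < x) :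
    HasDerivAt (fun y : ℝ => Real.exp (y ^ 2 / 4) * y ^ (-a) * k)
      (Real.exp (x ^ 2 / 4) * x ^ (1 - a) * (1 / 2 - a / x ^ 2) * k) x := by
  have h1 : HasDerivAt (fun x : ℝ => x ^ 2 / 4) (x / 2) x := by
    refine ((hasDerivAt_pow 2 x).div_const 4).congr_deriv ?_
    simp
    ring
  refine ((h1.exp.mul (Real.hasDerivAt_rpow_const (p := -a)
    (Or.inl hx.ne'))).mul_const k).congr_deriv ?_
  rw [show 1 - a = -a - 1 + 2 by ring, Real.rpow_add hx (-a - 1) 2,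
    show x ^ (-a) = x ^ (-a - 1) * x by
      rw [← Real.rpow_add_one hx.ne']; congr 1; ring]
  have : x ^ (2 : ℝ) = x ^ 2 := by
    rw [show (2 : ℝ) = ((2 : ℕ) : ℝ) by norm_num, Real.rpow_natCast]
  rw [this]
  field_simp
  ring

/-- This is where `a > 3/2` enters: `x^{2-2a}` is integrable at infinity exactly when `2 - 2a < -1`.
-/
lemma memLp_indicator_rpow {a s : ℝ} (ha : 3 / 2 < a) (hs : 0 < s) :
    MemLp ((Set.Ioi s).indicator fun x : ℝ => x ^ (1 - a)) (ENNReal.ofReal 2) := by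
  have hm : Measurable fun x : ℝ => x ^ (1 - a) := by fun_prop
  rw [memLp_indicator_iff_restrict measurableSet_Ioi,
    ← integrable_norm_rpow_iff hm.aestronglyMeasurable (by simp) ENNReal.ofReal_ne_top,
    ENNReal.toReal_ofReal zero_le_two]
  refine (integrableOn_Ioi_rpow_of_lt (a := 2 - 2 * a) (by linarith) hs).congr_fun
    (fun x hx => ?_) measurableSet_Ioi
  have hx0 : 0 < x := hs.trans hx
  dsimp only
  rw [Real.norm_of_nonneg (by positivity), ← Real.rpow_mul hx0.le]
  congr 1
  ring

lemma memLp_deriv_exampleFun {a : ℝ} {g : ℝ → ℝ} (ha : 3 / 2 < a) {C : ℝ}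
    (hg : ∀ x, |deriv g x| ≤ C) (hf : ContDiff ℝ 1 (exampleFun a g)) :
    MemLp (deriv (exampleFun a g)) (ENNReal.ofReal 2) (gaussianReal 0 1) := by
  set s := √(2 * a) with hs_def
  have hs : 0 < s := by positivity
  have hs2 : s ^ 2 = 2 * a := Real.sq_sqrt (by linarith)
  have hC : 0 ≤ C := (abs_nonneg _).trans (hg 0)
  set k : ℝ := (2 * Real.pi) ^ (1 / 4 : ℝ) with hk
  have hk0 : 0 ≤ k := by positivity
  -- Dominating function: the exponential branch to the right of `s`, the bound `C` on `g'` to its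
  -- left, and the value of the derivative at `s` itself, where the two branches meet.
  have hb := ((memLp_exp_sq_mul zero_lt_two (memLp_indicator_rpow ha hs)).const_mul k).add
    (memLp_const (μ := gaussianReal 0 1) (p := ENNReal.ofReal 2)
      (C + |deriv (exampleFun a g) s|))
  refine hb.mono' (hf.continuous_deriv le_rfl).aestronglyMeasurable
    (Eventually.of_forall fun x => ?_)
  rw [Real.norm_eq_abs, Pi.add_apply]
  rcases lt_trichotomy x s with hx | rfl | hx
  · have he : exampleFun a g =ᶠ[𝓝 x] g := by
      filter_upwards [Iio_mem_nhds hx] with y hy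
      exact if_neg (not_le.2 hy)
    rw [he.deriv_eq, Set.indicator_of_notMem (by simpa using hx.le)]
    have h1 := hg x
    have h2 := abs_nonneg (deriv (exampleFun a g) s)
    simp only [mul_zero, zero_add]
    linarith
  · rw [Set.indicator_of_notMem (by simp)]
    simp only [mul_zero, zero_add]
    linarith
  · have hx0 : 0 < x := hs.trans hx
    have he : exampleFun a g =ᶠ[𝓝 x] fun y => Real.exp (y ^ 2 / 4) * y ^ (-a) * k := by
      filter_upwards [Ioi_mem_nhds hx] with y hy
      exact if_pos (le_of_lt hy)
    rw [he.deriv_eq, (hasDerivAt_exp_sq_mul_rpow a k hx0).deriv,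
      Set.indicator_of_mem (show x ∈ Set.Ioi s from hx)]
    -- The threshold `√(2a)` is the critical point of the exponential branch; beyond it the factor
    -- `1/2 - a/x²` lies between `0` and `1/2`.
    have hq : a / x ^ 2 ≤ 1 / 2 := by
      rw [div_le_iff₀ (by positivity)]
      nlinarith
    have hq0 : 0 ≤ a / x ^ 2 := by positivity
    have hq1 : 0 ≤ 1 / 2 - a / x ^ 2 := by linarith
    rw [abs_of_nonneg (by positivity), show x ^ 2 / (2 * 2) = x ^ 2 / 4 by ring]
    have h1 : Real.exp (x ^ 2 / 4) * x ^ (1 - a) * (1 / 2 - a / x ^ 2) * k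
        ≤ Real.exp (x ^ 2 / 4) * x ^ (1 - a) * 1 * k := by
      gcongr
      linarith
    have h2 := abs_nonneg (deriv (exampleFun a g) s)
    linarith

lemma le_exampleFun (a : ℝ) (g : ℝ → ℝ) {x : ℝ} (hx : √(2 * a) ≤ x) :
    (2 * Real.pi) ^ (1 / 4 : ℝ) * (Real.exp (x ^ 2 / (2 * 2)) * x ^ (-a)) ≤ exampleFun a g x := by
  rw [exampleFun, if_pos hx, show x ^ 2 / (2 * 2) = x ^ 2 / 4 by ring, mul_comm]

end WienerCalculus


theorem theorem3p1 :
    (∀ p : ℝ, 1 < p → ∃ Z : WienerCalculus.PathSpace → ℝ,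
      WienerCalculus.MemMalliavinSobolev p Z ∧ ¬ WienerCalculus.SSGD p p Z) ∧
    (∀ (a : ℝ) (g : ℝ → ℝ), 3 / 2 < a →
      ContDiff ℝ 1 g → (∃ C : ℝ, ∀ x, |g x| ≤ C) → (∃ C : ℝ, ∀ x, |deriv g x| ≤ C) →
      ContDiff ℝ 1 (WienerCalculus.exampleFun a g) →
      ∀ Z : WienerCalculus.PathSpace → ℝ,
        Z = (fun ω => WienerCalculus.exampleFun a g (ω 1)) →
        WienerCalculus.MemMalliavinSobolev 2 Z ∧ ¬ WienerCalculus.SSGD 2 2 Z ∧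
        ∀ ε : ℝ, 0 < ε →
          ∫⁻ ω, ENNReal.ofReal
              (|WienerCalculus.diffQuotient Z WienerCalculus.unitDirection ε ω| ^ 2)
            ∂WienerCalculus.wienerMeasure = ⊤) := by
  refine ⟨fun p hp => ⟨fun ω => WienerCalculus.gaussGrowth p (ω 1), ?_⟩, ?_⟩
  · obtain ⟨h1, h2, -⟩ := WienerCalculus.sobolev_and_not_ssgd hp.le
      (WienerCalculus.contDiff_gaussGrowth p) (WienerCalculus.memLp_deriv_gaussGrowth hp.le)
      (c := 1 / 4) (by norm_num) (fun x hx => WienerCalculus.le_gaussGrowth p hx)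
    exact ⟨h1, h2⟩
  · rintro a g ha - - ⟨C, hC⟩ hf Z rfl
    obtain ⟨h1, h2, h3⟩ := WienerCalculus.sobolev_and_not_ssgd one_le_two hf
      (WienerCalculus.memLp_deriv_exampleFun ha hC hf) (c := (2 * Real.pi) ^ (1 / 4 : ℝ))
      (by positivity) (fun x hx => WienerCalculus.le_exampleFun a g hx)
    refine ⟨h1, h2, fun ε hε => ?_⟩
    rw [← h3 ε hε]
    refine MeasureTheory.lintegral_congr fun ω => ?_
    -- The square is a natural power in the statement and a real power in the general criterion.
    rw [ENNReal.ofReal_pow (abs_nonneg _), ← Real.norm_eq_abs, ofReal_norm, ENNReal.rpow_ofNat]
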